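/- A convex polyhedron (a bounded intersection of finitely many half-spaces in $\mathbb R^3$, with non-empty interior) is called $k$-equiprojective if its orthogonal projection is a convex $k$-gon in every direction that is not parallel to one of its faces. Let $P$ be a pentagonal rotunda (half of a regular icosidodecahedron, of any size and position). Its base is a regular decagon, and each base edge lies in one further face, alternately a pentagon and a triangle. The edges of $P$ not on the base are partitioned into five planar paths of length five, each joining two opposite base vertices and each containing exactly one edge of the top pentagon. Let $\mathcal P_1,\dots,\mathcal P_5$ be these paths in the cyclic order of their edges on the top pentagon. The end points of $\mathcal P_1,\mathcal P_3$ are the end points of two opposite (parallel) base edges, and so are the end points of $\mathcal P_2,\mathcal P_4$. A cut of $P$ by a plane removes the part of $P$ on one side of the plane. Consider the following cuts. * cut1, at a base vertex $x$ which is an end of $\mathcal P_i$: the plane is perpendicular to the base and to the plane of $\mathcal P_i$, and $x$ is the only vertex of $P$ removed. * A pair of a cut2 and a cut3 at the ends of $\mathcal P_1,\mathcal P_3$ (or of $\mathcal P_2,\mathcal P_4$): let $e,e'$ be the two opposite base edges whose end points are the ends of the two paths, where $e$ lies in a pentagon $p$ and $e'$ in a triangle $t$. The plane of cut2 is parallel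 to $p$, and the vertices removed by it are exactly the end points of $e'$. The plane of cut3 is parallel to $t$, and the vertices removed by it are exactly the end points of $e$. * cut4, at a vertex $x$ not on the base: $x$ is the only vertex of $P$ removed, and the plane meets the four edges at $x$ in the corners of a rectangle. No cutting plane passes through a vertex of $P$, and the depths of the cuts are otherwise arbitrary, subject to the condition that the pieces cut off (with their boundaries) are pairwise disjoint. Let $P_1$ be any polyhedron obtained from $P$ by a cut4 at every vertex not on the base, a pair of a cut2 and a cut3 at the ends of $\mathcal P_1,\mathcal P_3$, a pair of a cut2 and a cut3 at the ends of $\mathcal P_2,\mathcal P_4$, and a cut1 at each of the two ends of $\mathcal P_5$. Let $P_2$ be any polyhedron obtained in the same way, except that the pair of a cut2 and a cut3 at the ends of $\mathcal P_2,\mathcal P_4$ is replaced by a cut1 at each of the four ends of $\mathcal P_2$ and $\mathcal P_4$. Then such $P_1$ and $P_2$ exist, every such $P_1$ is a 21-equiprojective convex polyhedron, and every such $P_2$ is a 23-equiprojective convex polyhedron. -/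

import Mathlib

open scoped goldenRatio

namespace EquiRotunda

/-- Euclidean three-space. -/
abbrev E3 : Type := EuclideanSpace ℝ (Fin 3)

/-! ### Convex polyhedra, faces, shadows, equiprojectivity -/

/-- A closed half-space `{x | ⟪normal, x⟫ ≤ level}` with outward normal `normal ≠ 0`. -/
structure HalfSpace where
  normal : E3
  normal_ne_zero : normal ≠ 0
  level : ℝ

/-- The points of the closed half-space. -/
def HalfSpace.carrier (h : HalfSpace) : Set E3 := {x | inner ℝ h.normal x ≤ h.level}

/-- The bounding plane of the half-space. -/
def HalfSpace.plane (h : HalfSpace) : Set E3 := {x | inner ℝ h.normal x = h.level}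

/-- The complementary closed half-space: what a cut along `h.plane` removes, together with
the plane itself. -/
def HalfSpace.coCarrier (h : HalfSpace) : Set E3 := {x | h.level ≤ inner ℝ h.normal x}

/-- A (bounded, full-dimensional) convex polyhedron: a finite intersection of half-spaces. -/
def IsConvexPolyhedron (P : Set E3) : Prop :=
  Bornology.IsBounded P ∧ (interior P).Nonempty ∧
    ∃ S : Set HalfSpace, S.Finite ∧ P = ⋂ h ∈ S, h.carrier

/-- `F` is a (two-dimensional) face of `P`. -/
def IsFace (P F : Set E3) : Prop :=
  IsExposed ℝ P F ∧ Module.finrank ℝ (vectorSpan ℝ F) = 2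

/-- The shadow of `P` in direction `u`: its orthogonal projection to the plane `uᗮ`. -/
noncomputable def shadow (u : E3) (P : Set E3) : Set E3 :=
  (ℝ ∙ u)ᗮ.starProjection '' P

/-- `Q` is a convex `k`-gon: two-dimensional, the convex hull of its extreme points
(corners), of which there are exactly `k`. -/
def IsConvexGon (k : ℕ) (Q : Set E3) : Prop :=
  Module.finrank ℝ (vectorSpan ℝ Q) = 2 ∧
    (Q.extremePoints ℝ).encard = k ∧ convexHull ℝ (Q.extremePoints ℝ) = Q

/-- `P` is a `k`-equiprojective convex polyhedron: its shadow is a `k`-gon in every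
direction that is not parallel to a face. -/
def IsEquiprojective (k : ℕ) (P : Set E3) : Prop :=
  IsConvexPolyhedron P ∧
    ∀ u : E3, u ≠ 0 → (∀ F, IsFace P F → u ∉ vectorSpan ℝ F) → IsConvexGon k (shadow u P)

/-! ### The pentagonal rotunda -/

/-- Labels of the twenty vertices of a pentagonal rotunda (indices cyclic modulo 5).
* The base decagon is `a 0, b 0, a 1, b 1, a 2, b 2, a 3, b 3, a 4, b 4`.
* Pentagon `i` is `a i, b i, m i, t i, m (i-1)`; it meets the base in the edge `a i, b i`.
* Triangle `i` is `b i, a (i+1), m i`; it meets the base in the edge `b i, a (i+1)`.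
* The upper triangles are `m i, t i, t (i+1)`.
* The top pentagon is `t 0, t 1, t 2, t 3, t 4`. -/
inductive Vert
  | a (i : Fin 5)
  | b (i : Fin 5)
  | m (i : Fin 5)
  | t (i : Fin 5)

open Vert

/-- The vertices of the pentagonal rotunda of edge length 2 which is the half
`{(x, y, z) | 0 ≤ φ * y + z}` of the regular icosidodecahedron whose vertices are the cyclic
permutations of `(±2φ, 0, 0)` and of `(±1, ±φ, ±φ²)`. -/
noncomputable def stdVert : Vert → E3
  | a i => ![!₂[2 * φ, 0, 0], !₂[1, φ, -φ ^ 2], !₂[-φ ^ 2, 1, -φ], !₂[-φ ^ 2, -1, φ],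
      !₂[1, -φ, φ ^ 2]] i
  | b i => ![!₂[φ ^ 2, 1, -φ], !₂[-1, φ, -φ ^ 2], !₂[-(2 * φ), 0, 0], !₂[-1, -φ, φ ^ 2],
      !₂[φ ^ 2, -1, φ]] i
  | m i => ![!₂[φ, φ ^ 2, -1], !₂[-φ, φ ^ 2, -1], !₂[-φ ^ 2, 1, φ], !₂[0, 0, 2 * φ],
      !₂[φ ^ 2, 1, φ]] i
  | t i => ![!₂[φ, φ ^ 2, 1], !₂[0, 2 * φ, 0], !₂[-φ, φ ^ 2, 1], !₂[-1, φ, φ ^ 2],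
      !₂[1, φ, φ ^ 2]] i

/-- `v` labels the vertices of a pentagonal rotunda: it is a similar copy (of any size, in any
position, possibly reflected) of the standard one. -/
def IsPentagonalRotunda (v : Vert → E3) : Prop :=
  ∃ f : E3 ≃ᵈ E3, ∀ k, v k = f (stdVert k)

/-- The solid rotunda with vertices `v`. -/
def solid (v : Vert → E3) : Set E3 := convexHull ℝ (Set.range v)

/-- The vertex labels of the base decagon. -/
def baseFace : Set Vert := Set.range a ∪ Set.range b

/-- The vertex labels of the `i`-th pentagon adjacent to the base. -/
def pentagon (i : Fin 5) : Set Vert := {a i, b i, m i, t i, m (i - 1)}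

/-- The vertex labels of the `i`-th triangle adjacent to the base. -/
def triangle (i : Fin 5) : Set Vert := {b i, a (i + 1), m i}

/-- The `i`-th of the five planar paths (each with five edges, from a base vertex to the opposite
base vertex) which partition the edges not on the base. Its middle edge, on the top pentagon, is
`t (i+1), t (i+2)`; so in the cyclic order of these edges, the paths `0, 1, 2, 3, 4` are
`𝒫₁, 𝒫₂, 𝒫₃, 𝒫₄, 𝒫₅`. -/
def path (i : Fin 5) : Fin 6 → Vert :=
  ![b i, m i, t (i + 1), t (i + 2), m (i + 2), a (i + 3)]

/-- The four neighbours, in cyclic order, of a vertex `m i`. -/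
def nbrM (i : Fin 5) : Fin 4 → Vert := ![b i, a (i + 1), t (i + 1), t i]

/-- The four neighbours, in cyclic order, of a vertex `t i`. -/
def nbrT (i : Fin 5) : Fin 4 → Vert := ![m (i - 1), m i, t (i + 1), t (i - 1)]

/-! ### Cuts -/

/-- Cutting along `h.plane` removes the vertices in `S` and no other vertex (and the plane passes
through no vertex). -/
def Removes (v : Vert → E3) (h : HalfSpace) (S : Set Vert) : Prop :=
  (∀ k ∈ S, h.level < inner ℝ h.normal (v k)) ∧ ∀ k ∉ S, inner ℝ h.normal (v k) < h.level

/-- The plane of `h` is parallel to the plane through the vertices `S`. -/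
def ParallelTo (v : Vert → E3) (h : HalfSpace) (S : Set Vert) : Prop :=
  h.normal ∈ (vectorSpan ℝ (v '' S))ᗮ

/-- The plane of `h` is perpendicular to the plane through the vertices `S`. -/
def PerpendicularTo (v : Vert → E3) (h : HalfSpace) (S : Set Vert) : Prop :=
  h.normal ∈ vectorSpan ℝ (v '' S)

/-- The points `q 0, q 1, q 2, q 3`, in this order, are the corners of a rectangle. -/
def IsRectangle (q : Fin 4 → E3) : Prop :=
  q 1 - q 0 = q 2 - q 3 ∧ inner ℝ (q 1 - q 0) (q 3 - q 0) = 0 ∧ q 1 ≠ q 0 ∧ q 3 ≠ q 0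

/-- The plane of `h` meets the four edges from `v k` to `v (w j)` in the corners of a rectangle. -/
def CutsRectangle (v : Vert → E3) (h : HalfSpace) (k : Vert) (w : Fin 4 → Vert) : Prop :=
  ∃ q : Fin 4 → E3, (∀ j, q j ∈ segment ℝ (v k) (v (w j)) ∩ h.plane) ∧ IsRectangle q

/-- Names for the cuts.
* `cut1start i`, `cut1stop i` are the cuts of the first type at the two ends of path `i`.
* `cut2 i`, `cut3 i` are the cuts of the second and third type that belong to the parallel base
edges `a i, b i` (of the pentagon `i`) and `b (i+2), a (i+3)` (of the triangle `i+2`). The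
endpoints of these two edges are the ends of the paths `i` and `i+2`.
* `cut4m i`, `cut4t i` are the cuts of the fourth type at the vertices `m i`, `t i`. -/
inductive CutName
  | cut1start (i : Fin 5)
  | cut1stop (i : Fin 5)
  | cut2 (i : Fin 5)
  | cut3 (i : Fin 5)
  | cut4m (i : Fin 5)
  | cut4t (i : Fin 5)

open CutName

/-- Cutting `solid v` along `h.plane` is a cut of the named type at the named place. -/
def IsCut (v : Vert → E3) (h : HalfSpace) : CutName → Prop
  | cut1start i =>
      PerpendicularTo v h baseFace ∧ PerpendicularTo v h (Set.range (path i)) ∧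
        Removes v h {path i 0}
  | cut1stop i =>
      PerpendicularTo v h baseFace ∧ PerpendicularTo v h (Set.range (path i)) ∧
        Removes v h {path i 5}
  | cut2 i => ParallelTo v h (pentagon i) ∧ Removes v h {b (i + 2), a (i + 3)}
  | cut3 i => ParallelTo v h (triangle (i + 2)) ∧ Removes v h {a i, b i}
  | cut4m i => CutsRectangle v h (m i) (nbrM i) ∧ Removes v h {m i}
  | cut4t i => CutsRectangle v h (t i) (nbrT i) ∧ Removes v h {t i}

/-- `P` is obtained from `solid v` by applying cuts with the names in `C`, the pieces that they
cut off being pairwise disjoint. -/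
def IsTruncation (v : Vert → E3) (C : Set CutName) (P : Set E3) : Prop :=
  ∃ h : CutName → HalfSpace,
    (∀ c ∈ C, IsCut v (h c) c) ∧
    C.PairwiseDisjoint (fun c => solid v ∩ (h c).coCarrier) ∧
    P = solid v ∩ ⋂ c ∈ C, (h c).carrier

/-- The cuts of the fourth type, at all vertices that are not on the base. -/
def upperCuts : Set CutName := Set.range cut4m ∪ Set.range cut4t

/-- The first equitruncated pentagonal rotunda: a pair of cut2 and cut3 at the ends of `𝒫₁` and
`𝒫₃`, another such pair at the ends of `𝒫₂` and `𝒫₄`, a pair of cut1 at the ends of `𝒫₅`, and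
a cut4 at every vertex that is not on the base. -/
def IsFirstEquitruncatedRotunda (v : Vert → E3) (P : Set E3) : Prop :=
  IsTruncation v
    ({cut2 0, cut3 0} ∪ {cut2 1, cut3 1} ∪ {cut1start 4, cut1stop 4} ∪ upperCuts) P

/-- The second equitruncated pentagonal rotunda: instead of the second pair of cut2 and cut3,
two pairs of cut1 at the ends of `𝒫₂` and of `𝒫₄`. -/
def IsSecondEquitruncatedRotunda (v : Vert → E3) (P : Set E3) : Prop :=
  IsTruncation v
    ({cut2 0, cut3 0} ∪ ({cut1start 1, cut1stop 1} ∪ {cut1start 3, cut1stop 3}) ∪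
      {cut1start 4, cut1stop 4} ∪ upperCuts) P

end EquiRotunda

/-! Fix a direction u that is parallel to no face. The corners of the shadow come from the contour,
a set of vertices and edges of the polytope. An edge is a contour edge if the outward normals of its
two facets have inner products with u of opposite signs. A vertex is a contour vertex if the normals
of its three facets do not all have the same sign on u; in that case exactly two of its three edges
are contour edges. Every edge has two ends, so there are as many contour vertices as contour edges.
In a simple polytope, projection along u sends the contour vertices bijectively to the corners of
the shadow (`SimplePolytope.extremePoints_shadow`, `SimplePolytope.injOn_contour`). Equiprojectivity
thus means that the number of contour edges does not depend on u.

To count them, the edges of the truncation are partitioned into chains of successively adjacent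
facets whose normals turn in a half-plane from some p to -p. The inner product with u changes its
sign exactly once along such a half-turn, so each chain contains exactly one contour edge
(`IsHalfTurn.signChanges`). The number of corners is therefore the number of chains, 21 or 23. Every
chain joins two facets with opposite normals: base and top, the two cuts of type 1 on one path, a
cut2 and its pentagon, or a cut3 and its triangle.

The depths of the cuts do not matter. The conditions on a cut determine the direction of its normal
(`IsCut.exists_normal_eq`). Moreover, every vertex of the rotunda is removed by exactly one cut and
the removed pieces are disjoint. Hence the truncation is always the same simple polytope
combinatorially, with one vertex near each end of every edge whose two ends are removed by different
cuts (`CutPlanes.polytope`). Similarities reduce everything to the standard rotunda, where all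
remaining claims are finite computations in ℤ[φ]. -/

namespace EquiRotunda

/-! ### Simple polytopes -/

/-- A simple three-dimensional polytope, given by its facets and its vertices. -/
structure SimplePolytope (F V : Type*) where
  /-- The outward normals of the facets. -/
  normal : F → E3
  /-- The levels of the facets. -/
  level : F → ℝ
  /-- The vertices. -/
  point : V → E3
  /-- The three facets at a vertex. -/
  facets : V → Fin 3 → F
  le : ∀ v f, inner ℝ (normal f) (point v) ≤ level f
  eq_iff : ∀ v f, inner ℝ (normal f) (point v) = level f ↔ ∃ i, facets v i = f
  exists_nbr : ∀ v i, ∃ w, ∀ j, (∃ k, facets w k = facets v j) ↔ j ≠ i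
  eq_of_facets : ∀ v w, (∀ i, ∃ k, facets w k = facets v i) → v = w
  exists_vertex : ∀ f, ∃ v i, facets v i = f

namespace SimplePolytope

variable {F V : Type*} (S : SimplePolytope F V)

/-- The intersection of the half-spaces of the facets. -/
def body : Set E3 := {x | ∀ f, inner ℝ (S.normal f) x ≤ S.level f}

theorem point_mem_body (v : V) : S.point v ∈ S.body := fun f => S.le v f

theorem convex_body : Convex ℝ S.body := by
  have : S.body = ⋂ f, {x | inner ℝ (S.normal f) x ≤ S.level f} := by
    ext x; simp [body]
  rw [this]
  exact convex_iInter fun f => convex_halfSpace_le (innerₛₗ ℝ (S.normal f)).isLinear _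

theorem inner_facet (v : V) (i : Fin 3) :
    inner ℝ (S.normal (S.facets v i)) (S.point v) = S.level (S.facets v i) :=
  (S.eq_iff v _).2 ⟨i, rfl⟩

/-- The edge vectors at a vertex are, up to scaling, dual to the normals of the facets there. -/
theorem exists_edges (v : V) : ∃ w : Fin 3 → V,
    (∀ i, inner ℝ (S.normal (S.facets v i)) (S.point (w i) - S.point v) < 0) ∧
    ∀ i j, i ≠ j → inner ℝ (S.normal (S.facets v i)) (S.point (w j) - S.point v) = 0 := by
  choose w hw using S.exists_nbr v
  refine ⟨w, fun i => ?_, fun i j hij => ?_⟩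
  · rw [inner_sub_right, S.inner_facet, sub_neg]
    refine lt_of_le_of_ne (S.le _ _) fun h => ?_
    exact (hw i i).1 ((S.eq_iff _ _).1 h) rfl
  · rw [inner_sub_right, S.inner_facet, sub_eq_zero]
    exact (S.eq_iff _ _).2 ((hw j i).2 hij)

/-- Pairing a combination of the y j with n i isolates the i-th coefficient. So the y j are
independent, hence a basis in dimension three, and the coefficients of x can be read off. -/
theorem eq_sum_of_dual {n y : Fin 3 → E3} (h1 : ∀ i, inner ℝ (n i) (y i) < 0)
    (h0 : ∀ i j, i ≠ j → inner ℝ (n i) (y j) = 0) (x : E3) :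
    x = ∑ j, (inner ℝ (n j) x / inner ℝ (n j) (y j)) • y j := by
  have key : ∀ (c : Fin 3 → ℝ) (i : Fin 3),
      inner ℝ (n i) (∑ j, c j • y j) = c i * inner ℝ (n i) (y i) := by
    intro c i
    rw [inner_sum, Finset.sum_eq_single i]
    · rw [inner_smul_right]
    · intro j _ hj
      rw [inner_smul_right, h0 i j (Ne.symm hj), mul_zero]
    · simp
  have hli : LinearIndependent ℝ y := by
    rw [Fintype.linearIndependent_iff]
    intro c hc i
    have := key c i
    rw [hc, inner_zero_right] at this
    exact (mul_eq_zero.1 this.symm).resolve_right (h1 i).ne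
  have hspan : Submodule.span ℝ (Set.range y) = ⊤ :=
    hli.span_eq_top_of_card_eq_finrank (by simp [E3])
  obtain ⟨c, hc⟩ := (Submodule.mem_span_range_iff_exists_fun ℝ).1
    (hspan ▸ Submodule.mem_top : x ∈ Submodule.span ℝ (Set.range y))
  conv_lhs => rw [← hc]
  refine Finset.sum_congr rfl fun j _ => ?_
  rw [← hc, key, mul_div_cancel_right₀ _ (h1 j).ne]

theorem eq_zero_of_inner_facets (v : V) {x : E3}
    (h : ∀ i, inner ℝ (S.normal (S.facets v i)) x = 0) : x = 0 := by
  obtain ⟨w, h1, h0⟩ := S.exists_edges v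
  rw [eq_sum_of_dual h1 h0 x]
  simp [h]

theorem normal_ne_zero (f : F) : S.normal f ≠ 0 := by
  obtain ⟨v, i, rfl⟩ := S.exists_vertex f
  obtain ⟨w, h1, -⟩ := S.exists_edges v
  intro h
  have := h1 i
  rw [h, inner_zero_left] at this
  exact this.false

/-- The argument of the simplex method: a point outside the hull is strictly separated from it by a
functional. At a vertex where this functional is maximal it does not increase along the three edges,
and the body lies in the cone that they span, so it cannot be larger at the outside point. -/
theorem body_eq_convexHull [Finite V] [Nonempty V] :
    S.body = convexHull ℝ (Set.range S.point) := by
  refine Set.Subset.antisymm (fun x hx => ?_)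
    (convexHull_min (Set.range_subset_iff.2 S.point_mem_body) S.convex_body)
  by_contra hx'
  obtain ⟨l, c, h1, h2⟩ := geometric_hahn_banach_closed_point (convex_convexHull ℝ _)
    ((Set.finite_range S.point).isClosed_convexHull ℝ) hx'
  obtain ⟨v, hv⟩ := Finite.exists_max fun v => l (S.point v)
  obtain ⟨w, hw1, hw0⟩ := S.exists_edges v
  have hle : l (x - S.point v) ≤ 0 := by
    rw [eq_sum_of_dual hw1 hw0 (x - S.point v), map_sum]
    refine Finset.sum_nonpos fun j _ => ?_
    rw [map_smul, smul_eq_mul]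
    refine mul_nonpos_of_nonneg_of_nonpos (div_nonneg_of_nonpos ?_ (hw1 j).le) ?_
    · rw [inner_sub_right, S.inner_facet, sub_nonpos]
      exact hx _
    · rw [map_sub, sub_nonpos]
      exact hv _
  rw [map_sub, sub_nonpos] at hle
  have := h1 _ (subset_convexHull ℝ _ ⟨v, rfl⟩)
  linarith

theorem vectorSpan_eq_top_of_edges {n y : Fin 3 → E3} (h1 : ∀ i, inner ℝ (n i) (y i) < 0)
    (h0 : ∀ i j, i ≠ j → inner ℝ (n i) (y j) = 0) {A : Submodule ℝ E3} (hA : ∀ i, y i ∈ A) :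
    A = ⊤ := by
  rw [eq_top_iff]
  intro x _
  rw [eq_sum_of_dual h1 h0 x]
  exact A.sum_mem fun j _ => A.smul_mem _ (hA j)

theorem vectorSpan_body [Nonempty V] : vectorSpan ℝ S.body = ⊤ := by
  obtain ⟨v⟩ := ‹Nonempty V›
  obtain ⟨w, h1, h0⟩ := S.exists_edges v
  exact vectorSpan_eq_top_of_edges h1 h0 fun i =>
    vsub_mem_vectorSpan ℝ (S.point_mem_body _) (S.point_mem_body _)

theorem isConvexPolyhedron_body [Finite F] [Finite V] [Nonempty V] :
    IsConvexPolyhedron S.body := by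
  refine ⟨?_, ?_, Set.range fun f => ⟨S.normal f, S.normal_ne_zero f, S.level f⟩,
    Set.finite_range _, ?_⟩
  · rw [S.body_eq_convexHull]
    exact ((Set.finite_range S.point).isCompact_convexHull ℝ).isBounded
  · rw [← (S.convex_body.convexHull_eq), interior_convexHull_nonempty_iff_affineSpan_eq_top,
      AffineSubspace.affineSpan_eq_top_iff_vectorSpan_eq_top_of_nonempty]
    · exact S.vectorSpan_body
    · exact ‹Nonempty V›.elim fun v => ⟨_, S.point_mem_body v⟩
  · ext x
    simp [body, HalfSpace.carrier]

/-- The face of the polytope in the plane of a facet. -/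
def face (f : F) : Set E3 := {x ∈ S.body | inner ℝ (S.normal f) x = S.level f}

theorem vectorSpan_face (f : F) : vectorSpan ℝ (S.face f) = (ℝ ∙ S.normal f)ᗮ := by
  refine le_antisymm ?_ fun x hx => ?_
  · refine Submodule.span_le.2 ?_
    rintro _ ⟨x, hx, y, hy, rfl⟩
    rw [SetLike.mem_coe, Submodule.mem_orthogonal_singleton_iff_inner_right]
    exact (inner_sub_right _ _ _).trans (by rw [hx.2, hy.2, sub_self])
  · rw [Submodule.mem_orthogonal_singleton_iff_inner_right] at hx
    obtain ⟨v, i, rfl⟩ := S.exists_vertex f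
    obtain ⟨w, h1, h0⟩ := S.exists_edges v
    rw [eq_sum_of_dual h1 h0 x]
    refine Submodule.sum_mem _ fun j _ => ?_
    by_cases hj : i = j
    · subst hj
      simp [hx]
    · refine Submodule.smul_mem _ _ (vsub_mem_vectorSpan ℝ ⟨S.point_mem_body _, ?_⟩
        ⟨S.point_mem_body _, S.inner_facet _ _⟩)
      have := h0 i j hj
      rwa [inner_sub_right, S.inner_facet, sub_eq_zero] at this

theorem isFace_face (f : F) : IsFace S.body (S.face f) := by
  refine ⟨fun _ => ⟨innerSL ℝ (S.normal f), ?_⟩, ?_⟩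
  · obtain ⟨v, i, rfl⟩ := S.exists_vertex f
    ext x
    simp only [face, Set.mem_ofPred_eq, innerSL_apply_apply]
    refine and_congr_right fun hx => ⟨fun h y hy => h ▸ hy _, fun h => ?_⟩
    exact le_antisymm (hx _) (S.inner_facet v i ▸ h _ (S.point_mem_body v))
  · rw [S.vectorSpan_face]
    have : Fact (Module.finrank ℝ E3 = 2 + 1) := ⟨by simp [E3]⟩
    exact Submodule.finrank_orthogonal_span_singleton (S.normal_ne_zero f)

/-- A direction sees the normals at a vertex from both sides, so that the vertex is on the contour
of the polytope in this direction. -/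
def IsContour (u : E3) (v : V) : Prop :=
  (∃ i, inner ℝ (S.normal (S.facets v i)) u < 0) ∧
    ∃ i, 0 < inner ℝ (S.normal (S.facets v i)) u

theorem starProjection_eq_iff {u x y : E3} :
    (ℝ ∙ u)ᗮ.starProjection x = (ℝ ∙ u)ᗮ.starProjection y ↔ ∃ r : ℝ, y = x + r • u := by
  rw [eq_comm, ← sub_eq_zero, ← map_sub, Submodule.starProjection_apply_eq_zero_iff,
    Submodule.orthogonal_orthogonal, Submodule.mem_span_singleton]
  exact exists_congr fun r => by rw [eq_sub_iff_add_eq, eq_comm, add_comm]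

/-- A step from a contour vertex along u violates one of its facets, and a step along -u violates
another. -/
theorem eq_of_starProjection_eq {u : E3} {v : V} (hv : S.IsContour u v) {x : E3}
    (hx : x ∈ S.body)
    (h : (ℝ ∙ u)ᗮ.starProjection (S.point v) = (ℝ ∙ u)ᗮ.starProjection x) : x = S.point v := by
  obtain ⟨r, rfl⟩ := starProjection_eq_iff.1 h
  obtain ⟨⟨i, hi⟩, j, hj⟩ := hv
  have hr : ∀ k, r * inner ℝ (S.normal (S.facets v k)) u ≤ 0 := by
    intro k
    have := hx (S.facets v k)
    rw [inner_add_right, inner_smul_right, S.inner_facet] at this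
    linarith
  have h1 : r = 0 := by
    have := hr i
    have := hr j
    rcases lt_trichotomy r 0 with h | h | h
    · nlinarith
    · exact h
    · nlinarith
  simp [h1]

/-- A convex combination of x and y that projects to the same point as the vertex is the vertex
itself. The three facets there are then tight at x and at y as well, and they have only one common
point. -/
theorem starProjection_mem_extremePoints {u : E3} {v : V} (hv : S.IsContour u v) :
    (ℝ ∙ u)ᗮ.starProjection (S.point v) ∈ (shadow u S.body).extremePoints ℝ := by
  rw [mem_extremePoints]
  refine ⟨⟨_, S.point_mem_body v, rfl⟩, ?_⟩
  rintro _ ⟨x, hx, rfl⟩ _ ⟨y, hy, rfl⟩ ⟨a, b, ha, hb, hab, h⟩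
  rw [← map_smul, ← map_smul, ← map_add] at h
  have hxy := S.eq_of_starProjection_eq hv (S.convex_body hx hy ha.le hb.le hab) h.symm
  have key : ∀ i, inner ℝ (S.normal (S.facets v i)) (x - S.point v) = 0 ∧
      inner ℝ (S.normal (S.facets v i)) (y - S.point v) = 0 := by
    intro i
    have h1 := hx (S.facets v i)
    have h2 := hy (S.facets v i)
    have h3 := S.inner_facet v i
    rw [inner_sub_right, inner_sub_right, h3]
    rw [← hxy, inner_add_right, inner_smul_right, inner_smul_right] at h3
    have h4 := mul_nonneg ha.le (sub_nonneg.2 h1)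
    have h5 := mul_nonneg hb.le (sub_nonneg.2 h2)
    have h6 : a * (S.level (S.facets v i) - inner ℝ (S.normal (S.facets v i)) x) +
        b * (S.level (S.facets v i) - inner ℝ (S.normal (S.facets v i)) y) = 0 := by
      linear_combination S.level (S.facets v i) * hab - h3
    constructor
    · have : a * (S.level (S.facets v i) - inner ℝ (S.normal (S.facets v i)) x) = 0 := by linarith
      linarith [(mul_eq_zero.1 this).resolve_left ha.ne']
    · have : b * (S.level (S.facets v i) - inner ℝ (S.normal (S.facets v i)) y) = 0 := by linarith
      linarith [(mul_eq_zero.1 this).resolve_left hb.ne']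
  rw [sub_eq_zero.1 (S.eq_zero_of_inner_facets v fun i => (key i).1),
    sub_eq_zero.1 (S.eq_zero_of_inner_facets v fun i => (key i).2)]
  exact ⟨rfl, rfl⟩

/-- Here s • u points from the vertex into the interior of the polytope. The projected vertex is
then also the projection of interior points, and so it is the midpoint of two distinct points of the
shadow. -/
theorem not_mem_extremePoints_of_forall_lt {u : E3} {v : V} {s : ℝ}
    (hv : ∀ i, inner ℝ (S.normal (S.facets v i)) (s • u) < 0) :
    (ℝ ∙ u)ᗮ.starProjection (S.point v) ∉ (shadow u S.body).extremePoints ℝ := by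
  intro hext
  obtain ⟨w, h1, h0⟩ := S.exists_edges v
  set y : Fin 3 → E3 := fun j => S.point (w j) - S.point v with hy
  set t : Fin 3 → ℝ := fun j => inner ℝ (S.normal (S.facets v j)) (s • u) /
    inner ℝ (S.normal (S.facets v j)) (y j) with ht
  have htpos : ∀ j, 0 < t j := fun j => div_pos_of_neg_of_neg (hv j) (h1 j)
  have hu : s • u = ∑ j, t j • y j := eq_sum_of_dual h1 h0 (s • u)
  have hmem : ∀ c : Fin 3 → ℝ, (∀ j, 0 ≤ c j) → ∑ j, c j ≤ 1 →
      S.point v + ∑ j, c j • y j ∈ S.body := by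
    intro c hc hc1
    have : S.point v + ∑ j, c j • y j =
        (1 - ∑ j, c j) • S.point v + ∑ j, c j • S.point (w j) := by
      simp only [hy, smul_sub, Finset.sum_sub_distrib, sub_smul, Finset.sum_smul, one_smul]
      abel
    rw [this]
    have h := S.convex_body.sum_mem (t := (Finset.univ : Finset (Option (Fin 3))))
      (w := fun o => o.elim (1 - ∑ j, c j) c) (z := fun o => o.elim (S.point v) fun j => S.point (w j))
      (by rintro (_ | j) _; exacts [sub_nonneg.2 hc1, hc j])
      (by simp) (by rintro (_ | j) _; exacts [S.point_mem_body _, S.point_mem_body _])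
    simpa using h
  rw [Fin.sum_univ_three] at hu
  -- The scale e is so small that the two points below stay in the simplex spanned by the vertex and
  -- its neighbours. Their midpoint is the vertex plus (e * s) • u, and they differ by a multiple of
  -- the edge vector y 0.
  obtain ⟨e, he, hle⟩ : ∃ e : ℝ, 0 < e ∧ e * (2 * (t 0 + t 1 + t 2)) ≤ 1 :=
    ⟨1 / (2 * (t 0 + t 1 + t 2)), by have := htpos 0; have := htpos 1; have := htpos 2; positivity,
      by rw [one_div, inv_mul_cancel₀]; have := htpos 0; have := htpos 1; have := htpos 2; positivity⟩
  have ht0 := htpos 0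
  have ht1 := htpos 1
  have ht2 := htpos 2
  have hA := hmem ![2 * e * t 0, e * t 1, e * t 2]
    (by intro j; fin_cases j <;> simp <;> positivity)
    (by simp [Fin.sum_univ_three]; nlinarith [mul_pos he ht1, mul_pos he ht2])
  have hB := hmem ![0, e * t 1, e * t 2]
    (by intro j; fin_cases j <;> simp <;> positivity)
    (by simp [Fin.sum_univ_three]; nlinarith [mul_pos he ht1, mul_pos he ht2, mul_pos he ht0])
  have hmid := (mem_extremePoints.1 hext).2 _ ⟨_, hA, rfl⟩ _ ⟨_, hB, rfl⟩
    ⟨1 / 2, 1 / 2, by norm_num, by norm_num, by norm_num, by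
      rw [← map_smul, ← map_smul, ← map_add, eq_comm, starProjection_eq_iff]
      refine ⟨e * s, ?_⟩
      rw [mul_smul, hu]
      simp only [Fin.sum_univ_three, Matrix.cons_val]
      module⟩
  have hAB := hmid.1.trans hmid.2.symm
  rw [starProjection_eq_iff] at hAB
  obtain ⟨r, hr⟩ := hAB
  have hy0 : (2 * e * t 0) • y 0 + r • u = 0 := by
    simp only [Fin.sum_univ_three, Matrix.cons_val, zero_smul, zero_add] at hr
    rw [← add_assoc] at hr
    rw [← sub_eq_zero.2 hr.symm]
    module
  -- Pairing with the normal of facet 1 kills y 0 but not u, so y 0 is not parallel to u and the two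
  -- projections differ.
  have hr0 : r = 0 := by
    have h2 := congrArg (inner ℝ (S.normal (S.facets v 1))) hy0
    rw [inner_add_right, inner_smul_right, inner_smul_right, h0 1 0 (by decide), mul_zero, zero_add,
      inner_zero_right] at h2
    refine (mul_eq_zero.1 h2).resolve_right fun h3 => ?_
    have := hv 1
    rw [inner_smul_right, h3, mul_zero] at this
    exact this.false
  have h2 := congrArg (inner ℝ (S.normal (S.facets v 0))) hy0
  rw [hr0, zero_smul, add_zero, inner_smul_right, inner_zero_right] at h2
  exact (mul_neg_of_pos_of_neg (by positivity) (h1 0)).ne h2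

/-- The shadow is the hull of the projected vertices, so its corners are among them. At a vertex off
the contour, the three nonzero inner products with u share one sign, and
`not_mem_extremePoints_of_forall_lt` applies to u or to -u. -/
theorem extremePoints_shadow [Finite V] [Nonempty V] {u : E3}
    (hu : ∀ f, inner ℝ (S.normal f) u ≠ 0) :
    (shadow u S.body).extremePoints ℝ =
      (fun v => (ℝ ∙ u)ᗮ.starProjection (S.point v)) '' {v | S.IsContour u v} := by
  refine Set.Subset.antisymm (fun z hz => ?_) ?_
  · have hz' := hz
    have hsh : shadow u S.body = convexHull ℝ
        ((ℝ ∙ u)ᗮ.starProjection.toLinearMap '' Set.range S.point) := by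
      rw [← LinearMap.image_convexHull, ← S.body_eq_convexHull]
      rfl
    rw [hsh] at hz'
    obtain ⟨_, ⟨v, rfl⟩, rfl⟩ := extremePoints_convexHull_subset hz'
    refine ⟨v, ?_, rfl⟩
    by_contra hv
    simp only [Set.mem_ofPred_eq, IsContour, not_and_or, not_exists, not_lt] at hv
    rcases hv with hv | hv
    · refine S.not_mem_extremePoints_of_forall_lt (s := -1) (fun i => ?_) hz
      rw [inner_smul_right]
      have := lt_of_le_of_ne (hv i) (hu _).symm
      linarith
    · refine S.not_mem_extremePoints_of_forall_lt (s := 1) (fun i => ?_) hz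
      rw [one_smul]
      exact lt_of_le_of_ne (hv i) (hu _)
  · rintro _ ⟨v, hv, rfl⟩
    exact S.starProjection_mem_extremePoints hv

theorem injOn_contour (u : E3) :
    Set.InjOn (fun v => (ℝ ∙ u)ᗮ.starProjection (S.point v)) {v | S.IsContour u v} := by
  intro v hv w _ h
  have := S.eq_of_starProjection_eq hv (S.point_mem_body w) h
  exact S.eq_of_facets v w fun i => (S.eq_iff w _).1 (this ▸ S.inner_facet v i)

theorem isConvexGon_shadow [Finite V] [Nonempty V] {u : E3} (hu0 : u ≠ 0)
    (hu : ∀ f, inner ℝ (S.normal f) u ≠ 0) {k : ℕ} (hk : {v | S.IsContour u v}.ncard = k) :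
    IsConvexGon k (shadow u S.body) := by
  have hfin : ((shadow u S.body).extremePoints ℝ).Finite := by
    rw [S.extremePoints_shadow hu]
    exact (Set.toFinite _).image _
  have hconv : Convex ℝ (shadow u S.body) :=
    S.convex_body.linear_image (ℝ ∙ u)ᗮ.starProjection.toLinearMap
  have hcomp : IsCompact (shadow u S.body) := by
    refine IsCompact.image ?_ (ContinuousLinearMap.continuous _)
    rw [S.body_eq_convexHull]
    exact (Set.finite_range S.point).isCompact_convexHull ℝ
  refine ⟨?_, ?_, ?_⟩
  · have : vectorSpan ℝ (shadow u S.body) = (ℝ ∙ u)ᗮ := by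
      have h := (((ℝ ∙ u)ᗮ.starProjection.toLinearMap).toAffineMap).map_vectorSpan (s := S.body)
      rw [S.vectorSpan_body, Submodule.map_top] at h
      exact h.symm.trans (Submodule.range_starProjection _)
    rw [this]
    have : Fact (Module.finrank ℝ E3 = 2 + 1) := ⟨by simp [E3]⟩
    exact Submodule.finrank_orthogonal_span_singleton hu0
  · rw [S.extremePoints_shadow hu, (S.injOn_contour u).encard_image,
      ← (Set.toFinite _).cast_ncard_eq, hk]
  · have h := closure_convexHull_extremePoints hcomp hconv
    rwa [(hfin.isClosed_convexHull ℝ).closure_eq] at h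

/-- The face in the plane of a facet spans the orthogonal complement of its normal, so a direction
parallel to no face is orthogonal to no facet normal. -/
theorem isEquiprojective_body [Finite F] [Finite V] [Nonempty V] {k : ℕ}
    (hk : ∀ u : E3, (∀ f, inner ℝ (S.normal f) u ≠ 0) → {v | S.IsContour u v}.ncard = k) :
    IsEquiprojective k S.body := by
  refine ⟨S.isConvexPolyhedron_body, fun u hu0 hu => ?_⟩
  have hu' : ∀ f, inner ℝ (S.normal f) u ≠ 0 := fun f h0 =>
    hu _ (S.isFace_face f) (by
      rwa [S.vectorSpan_face, Submodule.mem_orthogonal_singleton_iff_inner_right])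
  exact S.isConvexGon_shadow hu0 hu' (hk u hu')

end SimplePolytope

/-! ### Similarities -/

/-- Dividing by the ratio gives a surjective isometry, which is affine by the Mazur–Ulam theorem. -/
theorem exists_similarity_parts (f : E3 ≃ᵈ E3) :
    ∃ (r : ℝ) (U : E3 ≃ₗᵢ[ℝ] E3), 0 < r ∧ ∀ x, f x = r • U x + f 0 := by
  set r : ℝ := (Dilation.ratio f : ℝ) with hr
  have hr0 : 0 < r := NNReal.coe_pos.2 (Dilation.ratio_pos f)
  let g : E3 ≃ᵢ E3 := IsometryEquiv.mk
    (f.toEquiv.trans (MulAction.toPerm (Units.mk0 r⁻¹ (inv_ne_zero hr0.ne'))))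
    (Isometry.of_dist_eq fun x y => by
      change dist (r⁻¹ • f x) (r⁻¹ • f y) = dist x y
      rw [dist_smul₀, Dilation.dist_eq, ← hr, Real.norm_of_nonneg (inv_nonneg.2 hr0.le),
        inv_mul_cancel_left₀ hr0.ne'])
  have hg : ∀ x, g x = r⁻¹ • f x := fun x => rfl
  refine ⟨r, g.toRealLinearIsometryEquiv, hr0, fun x => ?_⟩
  rw [IsometryEquiv.toRealLinearIsometryEquiv_apply, hg, hg, ← smul_sub, smul_inv_smul₀ hr0.ne',
    sub_add_cancel]

/-- The ratio of a similarity. -/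
noncomputable def simRatio (f : E3 ≃ᵈ E3) : ℝ := (exists_similarity_parts f).choose

/-- The orthogonal part of a similarity. -/
noncomputable def simPart (f : E3 ≃ᵈ E3) : E3 ≃ₗᵢ[ℝ] E3 :=
  (exists_similarity_parts f).choose_spec.choose

theorem simRatio_pos (f : E3 ≃ᵈ E3) : 0 < simRatio f :=
  (exists_similarity_parts f).choose_spec.choose_spec.1

theorem sim_apply (f : E3 ≃ᵈ E3) (x : E3) : f x = simRatio f • simPart f x + f 0 :=
  (exists_similarity_parts f).choose_spec.choose_spec.2 x

theorem sim_sub (f : E3 ≃ᵈ E3) (x y : E3) : f x - f y = simRatio f • simPart f (x - y) := by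
  rw [sim_apply f x, sim_apply f y, map_sub, smul_sub]
  abel

/-- A similarity as an affine map. -/
noncomputable def simAffine (f : E3 ≃ᵈ E3) : E3 →ᵃ[ℝ] E3 where
  toFun := f
  linear := simRatio f • (simPart f).toLinearEquiv.toLinearMap
  map_vadd' p w := by
    rw [vadd_eq_add, vadd_eq_add, ← sub_eq_iff_eq_add, sim_sub, add_sub_cancel_right]
    rfl

/-- The change of the level of a half-space with normal `n` under a similarity. -/
noncomputable def simShift (f : E3 ≃ᵈ E3) (n : E3) : ℝ := inner ℝ (simPart f n) (f 0)

theorem inner_sim (f : E3 ≃ᵈ E3) (n x : E3) :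
    inner ℝ (simPart f n) (f x) = simRatio f * inner ℝ n x + simShift f n := by
  rw [simShift, sim_apply f x, inner_add_right, inner_smul_right, LinearIsometryEquiv.inner_map_map]

/-- The image of a half-space under a similarity. -/
noncomputable def HalfSpace.map (f : E3 ≃ᵈ E3) (h : HalfSpace) : HalfSpace where
  normal := simPart f h.normal
  normal_ne_zero := by simpa using h.normal_ne_zero
  level := simRatio f * h.level + simShift f h.normal

theorem HalfSpace.apply_mem_carrier_map (f : E3 ≃ᵈ E3) (h : HalfSpace) (x : E3) :
    f x ∈ (h.map f).carrier ↔ x ∈ h.carrier := by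
  simp only [HalfSpace.carrier, HalfSpace.map, Set.mem_ofPred_eq, inner_sim, add_le_add_iff_right,
    mul_le_mul_iff_right₀ (simRatio_pos f)]

theorem HalfSpace.apply_mem_coCarrier_map (f : E3 ≃ᵈ E3) (h : HalfSpace) (x : E3) :
    f x ∈ (h.map f).coCarrier ↔ x ∈ h.coCarrier := by
  simp only [HalfSpace.coCarrier, HalfSpace.map, Set.mem_ofPred_eq, inner_sim,
    add_le_add_iff_right, mul_le_mul_iff_right₀ (simRatio_pos f)]

theorem HalfSpace.apply_mem_plane_map (f : E3 ≃ᵈ E3) (h : HalfSpace) (x : E3) :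
    f x ∈ (h.map f).plane ↔ x ∈ h.plane := by
  simp only [HalfSpace.plane, HalfSpace.map, Set.mem_ofPred_eq, inner_sim,
    add_left_inj, mul_right_inj' (simRatio_pos f).ne']

theorem vectorSpan_sim (f : E3 ≃ᵈ E3) (v : Vert → E3) (S : Set Vert) :
    vectorSpan ℝ ((f ∘ v) '' S) =
      (vectorSpan ℝ (v '' S)).map (simRatio f • (simPart f).toLinearEquiv.toLinearMap) := by
  rw [Set.image_comp]
  exact ((simAffine f).map_vectorSpan (s := v '' S)).symm

theorem PerpendicularTo.map (f : E3 ≃ᵈ E3) {v : Vert → E3} {h : HalfSpace} {S : Set Vert}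
    (hS : PerpendicularTo v h S) : PerpendicularTo (f ∘ v) (h.map f) S := by
  unfold PerpendicularTo at *
  rw [vectorSpan_sim]
  refine ⟨(simRatio f)⁻¹ • h.normal, Submodule.smul_mem _ _ hS, ?_⟩
  simp [HalfSpace.map, (simRatio_pos f).ne']

theorem ParallelTo.map (f : E3 ≃ᵈ E3) {v : Vert → E3} {h : HalfSpace} {S : Set Vert}
    (hS : ParallelTo v h S) : ParallelTo (f ∘ v) (h.map f) S := by
  unfold ParallelTo at *
  rw [vectorSpan_sim, Submodule.mem_orthogonal]
  rintro _ ⟨x, hx, rfl⟩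
  have := (Submodule.mem_orthogonal _ _).1 hS x hx
  simp only [HalfSpace.map, LinearMap.smul_apply, LinearEquiv.coe_coe,
    LinearIsometryEquiv.coe_toLinearEquiv, inner_smul_left, LinearIsometryEquiv.inner_map_map,
    this, mul_zero]

theorem Removes.map (f : E3 ≃ᵈ E3) {v : Vert → E3} {h : HalfSpace} {S : Set Vert}
    (hS : Removes v h S) : Removes (f ∘ v) (h.map f) S := by
  simpa only [Removes, HalfSpace.map, Function.comp_apply, inner_sim, add_lt_add_iff_right,
    mul_lt_mul_iff_right₀ (simRatio_pos f)] using hS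

theorem IsRectangle.map (f : E3 ≃ᵈ E3) {q : Fin 4 → E3} (hq : IsRectangle q) :
    IsRectangle (f ∘ q) := by
  obtain ⟨h1, h2, h3, h4⟩ := hq
  refine ⟨?_, ?_, ?_, ?_⟩
  · simp only [Function.comp_apply, sim_sub, h1]
  · simp only [Function.comp_apply, sim_sub, inner_smul_left, inner_smul_right,
      LinearIsometryEquiv.inner_map_map, h2, mul_zero]
  · exact fun h => h3 (f.injective h)
  · exact fun h => h4 (f.injective h)

theorem CutsRectangle.map (f : E3 ≃ᵈ E3) {v : Vert → E3} {h : HalfSpace} {k : Vert}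
    {w : Fin 4 → Vert} (hS : CutsRectangle v h k w) : CutsRectangle (f ∘ v) (h.map f) k w := by
  obtain ⟨q, hq, hr⟩ := hS
  refine ⟨f ∘ q, fun j => ⟨?_, (h.apply_mem_plane_map f _).2 (hq j).2⟩, hr.map f⟩
  have := Set.mem_image_of_mem (simAffine f) (hq j).1
  rwa [image_segment] at this

theorem IsCut.map (f : E3 ≃ᵈ E3) {v : Vert → E3} {h : HalfSpace} {c : CutName}
    (hc : IsCut v h c) : IsCut (f ∘ v) (h.map f) c := by
  cases c with
  | cut1start i => exact ⟨hc.1.map f, hc.2.1.map f, hc.2.2.map f⟩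
  | cut1stop i => exact ⟨hc.1.map f, hc.2.1.map f, hc.2.2.map f⟩
  | cut2 i => exact ⟨hc.1.map f, hc.2.map f⟩
  | cut3 i => exact ⟨hc.1.map f, hc.2.map f⟩
  | cut4m i => exact ⟨hc.1.map f, hc.2.map f⟩
  | cut4t i => exact ⟨hc.1.map f, hc.2.map f⟩

theorem apply_mem_solid (f : E3 ≃ᵈ E3) (v : Vert → E3) (x : E3) :
    f x ∈ solid (f ∘ v) ↔ x ∈ solid v := by
  have h : solid (f ∘ v) = f '' solid v := by
    unfold solid
    rw [Set.range_comp]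
    exact ((simAffine f).image_convexHull _).symm
  rw [h, f.injective.mem_set_image]

theorem IsTruncation.map (f : E3 ≃ᵈ E3) {v : Vert → E3} {C : Set CutName} {P : Set E3}
    (hP : IsTruncation v C P) : IsTruncation (f ∘ v) C (f '' P) := by
  obtain ⟨h, hc, hd, rfl⟩ := hP
  refine ⟨fun c => (h c).map f, fun c hcC => (hc c hcC).map f, fun c hcC c' hcC' hne => ?_, ?_⟩
  · refine Set.disjoint_left.2 fun y => ?_
    obtain ⟨x, rfl⟩ := f.surjective y
    simp only [Set.mem_inter_iff, HalfSpace.apply_mem_coCarrier_map, apply_mem_solid]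
    exact fun h1 h2 => Set.disjoint_left.1 (hd hcC hcC' hne) h1 h2
  · ext y
    obtain ⟨x, rfl⟩ := f.surjective y
    simp only [f.injective.mem_set_image, Set.mem_inter_iff, Set.mem_iInter,
      HalfSpace.apply_mem_carrier_map, apply_mem_solid]

/-- The image of a simple polytope under a similarity. -/
noncomputable def SimplePolytope.map {F V : Type*} (f : E3 ≃ᵈ E3) (S : SimplePolytope F V) :
    SimplePolytope F V where
  normal i := simPart f (S.normal i)
  level i := simRatio f * S.level i + simShift f (S.normal i)
  point v := f (S.point v)
  facets := S.facets
  le v i := by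
    rw [inner_sim]
    exact add_le_add_left (mul_le_mul_of_nonneg_left (S.le v i) (simRatio_pos f).le) _
  eq_iff v i := by
    rw [inner_sim, add_left_inj, mul_right_inj' (simRatio_pos f).ne']
    exact S.eq_iff v i
  exists_nbr := S.exists_nbr
  eq_of_facets := S.eq_of_facets
  exists_vertex := S.exists_vertex

theorem SimplePolytope.body_map {F V : Type*} (f : E3 ≃ᵈ E3) (S : SimplePolytope F V) :
    (S.map f).body = f '' S.body := by
  ext y
  obtain ⟨x, rfl⟩ := f.surjective y
  simp only [f.injective.mem_set_image, SimplePolytope.body, SimplePolytope.map,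
    Set.mem_ofPred_eq, inner_sim, add_le_add_iff_right, mul_le_mul_iff_right₀ (simRatio_pos f)]

/-- The contour of the image in direction u is the contour of the original in the direction pulled
back by the orthogonal part. -/
theorem SimplePolytope.isEquiprojective_image {F V : Type*} [Finite F] [Finite V] [Nonempty V]
    (f : E3 ≃ᵈ E3) (S : SimplePolytope F V) {k : ℕ}
    (hk : ∀ u : E3, (∀ i, inner ℝ (S.normal i) u ≠ 0) → {v | S.IsContour u v}.ncard = k) :
    IsEquiprojective k (f '' S.body) := by
  rw [← S.body_map]
  refine (S.map f).isEquiprojective_body fun u hu => ?_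
  have key : ∀ i, inner ℝ ((S.map f).normal i) u = inner ℝ (S.normal i) ((simPart f).symm u) := by
    intro i
    rw [← (simPart f).inner_map_map (S.normal i), LinearIsometryEquiv.apply_symm_apply]
    rfl
  rw [← hk ((simPart f).symm u) fun i => key i ▸ hu i]
  congr 1
  ext v
  simp only [Set.mem_ofPred_eq, IsContour, key]
  rfl

/-! ### Vectors with coordinates in `ℤ[φ]` -/

/-- The number `re + im * φ`. -/
structure GoldenInt where
  re : ℤ
  im : ℤ
deriving DecidableEq

namespace GoldenInt

instance : Add GoldenInt := ⟨fun x y => ⟨x.re + y.re, x.im + y.im⟩⟩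
instance : Sub GoldenInt := ⟨fun x y => ⟨x.re - y.re, x.im - y.im⟩⟩
instance : Neg GoldenInt := ⟨fun x => ⟨-x.re, -x.im⟩⟩
instance : Mul GoldenInt :=
  ⟨fun x y => ⟨x.re * y.re + x.im * y.im, x.re * y.im + x.im * y.re + x.im * y.im⟩⟩
instance : Zero GoldenInt := ⟨⟨0, 0⟩⟩

/-- The value of `re + im * φ` as a real number. -/
noncomputable def toReal (x : GoldenInt) : ℝ := x.re + x.im * φ

theorem toReal_add (x y : GoldenInt) : (x + y).toReal = x.toReal + y.toReal := by
  change ((x.re + y.re : ℤ) : ℝ) + ((x.im + y.im : ℤ) : ℝ) * φ = _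
  simp only [toReal]
  push_cast
  ring

theorem toReal_sub (x y : GoldenInt) : (x - y).toReal = x.toReal - y.toReal := by
  change ((x.re - y.re : ℤ) : ℝ) + ((x.im - y.im : ℤ) : ℝ) * φ = _
  simp only [toReal]
  push_cast
  ring

theorem toReal_neg (x : GoldenInt) : (-x).toReal = -x.toReal := by
  change ((-x.re : ℤ) : ℝ) + ((-x.im : ℤ) : ℝ) * φ = _
  simp only [toReal]
  push_cast
  ring

theorem toReal_mul (x y : GoldenInt) : (x * y).toReal = x.toReal * y.toReal := by
  change ((x.re * y.re + x.im * y.im : ℤ) : ℝ) +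
    ((x.re * y.im + x.im * y.re + x.im * y.im : ℤ) : ℝ) * φ = _
  simp only [toReal]
  push_cast
  linear_combination (-(x.im : ℝ) * y.im) * Real.goldenRatio_sq

theorem toReal_zero : (0 : GoldenInt).toReal = 0 := by
  change ((0 : ℤ) : ℝ) + ((0 : ℤ) : ℝ) * φ = 0
  simp

/-- A sufficient condition for positivity, by means of `1.618 < φ < 1.6181`. -/
def IsPos (x : GoldenInt) : Prop :=
  0 < 1000 * x.re + 1618 * x.im ∧ 0 < 10000 * x.re + 16181 * x.im

instance (x : GoldenInt) : Decidable x.IsPos := by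
  unfold IsPos
  infer_instance

theorem IsPos.toReal_pos {x : GoldenInt} (hx : x.IsPos) : 0 < x.toReal := by
  obtain ⟨h1, h2⟩ := hx
  have h1' : (0 : ℝ) < 1000 * x.re + 1618 * x.im := by exact_mod_cast h1
  have h2' : (0 : ℝ) < 10000 * x.re + 16181 * x.im := by exact_mod_cast h2
  have hs : (√5 : ℝ) ^ 2 = 5 := Real.sq_sqrt (by norm_num)
  have hs0 : 0 ≤ (√5 : ℝ) := Real.sqrt_nonneg 5
  have hlo : 1.618 < φ := by
    unfold Real.goldenRatio
    nlinarith
  have hhi : φ < 1.6181 := by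
    unfold Real.goldenRatio
    nlinarith
  unfold toReal
  -- The value is affine in φ, so positivity at both ends of the interval suffices; the sign of `im`
  -- decides which end gives the lower bound.
  rcases le_total 0 (x.im : ℝ) with h | h <;> nlinarith

end GoldenInt

/-- A vector with coordinates in `ℤ[φ]`. -/
structure GoldenVec where
  x : GoldenInt
  y : GoldenInt
  z : GoldenInt
deriving DecidableEq

namespace GoldenVec

instance : Add GoldenVec := ⟨fun u v => ⟨u.x + v.x, u.y + v.y, u.z + v.z⟩⟩
instance : Sub GoldenVec := ⟨fun u v => ⟨u.x - v.x, u.y - v.y, u.z - v.z⟩⟩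
instance : Neg GoldenVec := ⟨fun u => ⟨-u.x, -u.y, -u.z⟩⟩
instance : SMul GoldenInt GoldenVec := ⟨fun c u => ⟨c * u.x, c * u.y, c * u.z⟩⟩

/-- The inner product. -/
def dot (u v : GoldenVec) : GoldenInt := u.x * v.x + u.y * v.y + u.z * v.z

/-- The cross product. -/
def cross (u v : GoldenVec) : GoldenVec :=
  ⟨u.y * v.z - u.z * v.y, u.z * v.x - u.x * v.z, u.x * v.y - u.y * v.x⟩

/-- The determinant. -/
def det (u v w : GoldenVec) : GoldenInt := (u.cross v).dot w

/-- The vector as a point of Euclidean space. -/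
noncomputable def toE3 (u : GoldenVec) : E3 := !₂[u.x.toReal, u.y.toReal, u.z.toReal]

theorem toE3_add (u v : GoldenVec) : (u + v).toE3 = u.toE3 + v.toE3 := by
  ext i
  fin_cases i
  exacts [GoldenInt.toReal_add u.x v.x, GoldenInt.toReal_add u.y v.y, GoldenInt.toReal_add u.z v.z]

theorem toE3_sub (u v : GoldenVec) : (u - v).toE3 = u.toE3 - v.toE3 := by
  ext i
  fin_cases i
  exacts [GoldenInt.toReal_sub u.x v.x, GoldenInt.toReal_sub u.y v.y, GoldenInt.toReal_sub u.z v.z]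

theorem toE3_neg (u : GoldenVec) : (-u).toE3 = -u.toE3 := by
  ext i
  fin_cases i
  exacts [GoldenInt.toReal_neg u.x, GoldenInt.toReal_neg u.y, GoldenInt.toReal_neg u.z]

theorem toE3_smul (c : GoldenInt) (u : GoldenVec) : (c • u).toE3 = c.toReal • u.toE3 := by
  ext i
  fin_cases i
  exacts [GoldenInt.toReal_mul c u.x, GoldenInt.toReal_mul c u.y, GoldenInt.toReal_mul c u.z]

theorem inner_toE3_left (u : GoldenVec) (n : E3) :
    inner ℝ u.toE3 n = u.x.toReal * n 0 + u.y.toReal * n 1 + u.z.toReal * n 2 := by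
  simp [toE3, PiLp.inner_apply, Fin.sum_univ_three, mul_comm]

theorem inner_toE3 (u v : GoldenVec) : inner ℝ u.toE3 v.toE3 = (u.dot v).toReal := by
  rw [inner_toE3_left, dot]
  simp only [GoldenInt.toReal_add, GoldenInt.toReal_mul]
  rfl

/-- Cramer's rule; the multipliers in the linear combinations are the cofactors. -/
theorem eq_zero_of_inner_eq_zero {u v w : GoldenVec} {n : E3} (hdet : (det u v w).toReal ≠ 0)
    (hu : inner ℝ u.toE3 n = 0) (hv : inner ℝ v.toE3 n = 0) (hw : inner ℝ w.toE3 n = 0) :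
    n = 0 := by
  simp only [det, dot, cross, GoldenInt.toReal_add, GoldenInt.toReal_mul,
    GoldenInt.toReal_sub] at hdet
  rw [inner_toE3_left] at hu hv hw
  ext i
  fin_cases i
  · refine (mul_eq_zero.1 ?_).resolve_left hdet
    change _ * n 0 = 0
    linear_combination (v.y.toReal * w.z.toReal - v.z.toReal * w.y.toReal) * hu +
      (w.y.toReal * u.z.toReal - w.z.toReal * u.y.toReal) * hv +
      (u.y.toReal * v.z.toReal - u.z.toReal * v.y.toReal) * hw
  · refine (mul_eq_zero.1 ?_).resolve_left hdet
    change _ * n 1 = 0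
    linear_combination (v.z.toReal * w.x.toReal - v.x.toReal * w.z.toReal) * hu +
      (w.z.toReal * u.x.toReal - w.x.toReal * u.z.toReal) * hv +
      (u.z.toReal * v.x.toReal - u.x.toReal * v.z.toReal) * hw
  · refine (mul_eq_zero.1 ?_).resolve_left hdet
    change _ * n 2 = 0
    linear_combination (v.x.toReal * w.y.toReal - v.y.toReal * w.x.toReal) * hu +
      (w.x.toReal * u.y.toReal - w.y.toReal * u.x.toReal) * hv +
      (u.x.toReal * v.y.toReal - u.y.toReal * v.x.toReal) * hw

/-- Cramer's rule for the transposed system. -/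
theorem coeff_eq_zero {u v w : GoldenVec} {a b c : ℝ} (hdet : (det u v w).toReal ≠ 0)
    (h : a • u.toE3 + b • v.toE3 + c • w.toE3 = 0) : a = 0 ∧ b = 0 ∧ c = 0 := by
  simp only [det, dot, cross, GoldenInt.toReal_add, GoldenInt.toReal_mul,
    GoldenInt.toReal_sub] at hdet
  have h0 : a * u.x.toReal + b * v.x.toReal + c * w.x.toReal = 0 := by
    simpa [toE3] using congrArg (fun p : E3 => p 0) h
  have h1 : a * u.y.toReal + b * v.y.toReal + c * w.y.toReal = 0 := by
    simpa [toE3] using congrArg (fun p : E3 => p 1) h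
  have h2 : a * u.z.toReal + b * v.z.toReal + c * w.z.toReal = 0 := by
    simpa [toE3] using congrArg (fun p : E3 => p 2) h
  refine ⟨(mul_eq_zero.1 ?_).resolve_left hdet, (mul_eq_zero.1 ?_).resolve_left hdet,
    (mul_eq_zero.1 ?_).resolve_left hdet⟩
  · linear_combination (v.y.toReal * w.z.toReal - v.z.toReal * w.y.toReal) * h0 +
      (v.z.toReal * w.x.toReal - v.x.toReal * w.z.toReal) * h1 +
      (v.x.toReal * w.y.toReal - v.y.toReal * w.x.toReal) * h2
  · linear_combination (w.y.toReal * u.z.toReal - w.z.toReal * u.y.toReal) * h0 +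
      (w.z.toReal * u.x.toReal - w.x.toReal * u.z.toReal) * h1 +
      (w.x.toReal * u.y.toReal - w.y.toReal * u.x.toReal) * h2
  · linear_combination (u.y.toReal * v.z.toReal - u.z.toReal * v.y.toReal) * h0 +
      (u.z.toReal * v.x.toReal - u.x.toReal * v.z.toReal) * h1 +
      (u.x.toReal * v.y.toReal - u.y.toReal * v.x.toReal) * h2

/-- A vector that is orthogonal to `u` and `v` is a multiple of `w`, if `w` is orthogonal to the
independent vectors `u` and `v`. -/
theorem exists_pos_smul {u v w p q : GoldenVec} {n : E3} (hu : inner ℝ u.toE3 n = 0)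
    (hv : inner ℝ v.toE3 n = 0) (hwu : w.dot u = 0) (hwv : w.dot v = 0)
    (hdet : (det u v w * det u v w).IsPos) (hpq : (w.dot p - w.dot q).IsPos)
    (hn : inner ℝ n q.toE3 < inner ℝ n p.toE3) : ∃ c : ℝ, 0 < c ∧ n = c • w.toE3 := by
  -- The certificate is positivity of the square, so that one test covers both orientations.
  have hdet' : (det u v w).toReal ≠ 0 := fun h0 => by
    have := hdet.toReal_pos
    rw [GoldenInt.toReal_mul, h0, mul_zero] at this
    exact this.false
  have hpq' := hpq.toReal_pos
  have hww : inner ℝ w.toE3 w.toE3 ≠ 0 := fun h0 => by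
    have h1 := inner_self_eq_zero.1 h0
    rw [GoldenInt.toReal_sub, ← inner_toE3, ← inner_toE3, h1] at hpq'
    simp at hpq'
  set c := inner ℝ w.toE3 n / inner ℝ w.toE3 w.toE3 with hc
  have hzero : n - c • w.toE3 = 0 := by
    refine eq_zero_of_inner_eq_zero hdet' ?_ ?_ ?_
    · rw [inner_sub_right, inner_smul_right, hu, real_inner_comm, inner_toE3, hwu,
        GoldenInt.toReal_zero]
      ring
    · rw [inner_sub_right, inner_smul_right, hv, real_inner_comm, inner_toE3, hwv,
        GoldenInt.toReal_zero]
      ring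
    · rw [inner_sub_right, inner_smul_right, hc, div_mul_cancel₀ _ hww, sub_self]
  have hn' := sub_eq_zero.1 hzero
  refine ⟨c, ?_, hn'⟩
  rw [hn', inner_smul_left, inner_smul_left, inner_toE3, inner_toE3] at hn
  rw [GoldenInt.toReal_sub] at hpq'
  simp only [conj_trivial] at hn
  nlinarith

end GoldenVec

/-! ### The combinatorial data of the rotunda -/

deriving instance DecidableEq, Fintype for Vert
deriving instance DecidableEq, Fintype for CutName

open Vert CutName

/-- The coordinates of the vertices of the standard rotunda. -/
def coord : Vert → GoldenVec
  | a i => ![⟨⟨0, 2⟩, ⟨0, 0⟩, ⟨0, 0⟩⟩, ⟨⟨1, 0⟩, ⟨0, 1⟩, ⟨-1, -1⟩⟩, ⟨⟨-1, -1⟩, ⟨1, 0⟩, ⟨0, -1⟩⟩,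
      ⟨⟨-1, -1⟩, ⟨-1, 0⟩, ⟨0, 1⟩⟩, ⟨⟨1, 0⟩, ⟨0, -1⟩, ⟨1, 1⟩⟩] i
  | b i => ![⟨⟨1, 1⟩, ⟨1, 0⟩, ⟨0, -1⟩⟩, ⟨⟨-1, 0⟩, ⟨0, 1⟩, ⟨-1, -1⟩⟩, ⟨⟨0, -2⟩, ⟨0, 0⟩, ⟨0, 0⟩⟩,
      ⟨⟨-1, 0⟩, ⟨0, -1⟩, ⟨1, 1⟩⟩, ⟨⟨1, 1⟩, ⟨-1, 0⟩, ⟨0, 1⟩⟩] i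
  | m i => ![⟨⟨0, 1⟩, ⟨1, 1⟩, ⟨-1, 0⟩⟩, ⟨⟨0, -1⟩, ⟨1, 1⟩, ⟨-1, 0⟩⟩, ⟨⟨-1, -1⟩, ⟨1, 0⟩, ⟨0, 1⟩⟩,
      ⟨⟨0, 0⟩, ⟨0, 0⟩, ⟨0, 2⟩⟩, ⟨⟨1, 1⟩, ⟨1, 0⟩, ⟨0, 1⟩⟩] i
  | t i => ![⟨⟨0, 1⟩, ⟨1, 1⟩, ⟨1, 0⟩⟩, ⟨⟨0, 0⟩, ⟨0, 2⟩, ⟨0, 0⟩⟩, ⟨⟨0, -1⟩, ⟨1, 1⟩, ⟨1, 0⟩⟩,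
      ⟨⟨-1, 0⟩, ⟨0, 1⟩, ⟨1, 1⟩⟩, ⟨⟨1, 0⟩, ⟨0, 1⟩, ⟨1, 1⟩⟩] i

theorem stdVert_eq_coord (k : Vert) : stdVert k = (coord k).toE3 := by
  rcases k with i | i | i | i <;> fin_cases i <;>
  · ext j
    fin_cases j <;>
      simp [stdVert, coord, GoldenVec.toE3, GoldenInt.toReal, Real.goldenRatio_sq] <;> ring

/-- The faces of the rotunda: the base, the top pentagon, the pentagons and triangles at the base,
and the upper triangles `m i, t i, t (i + 1)`. -/
inductive Side
  | base
  | top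
  | pent (i : Fin 5)
  | tri (i : Fin 5)
  | up (i : Fin 5)
deriving DecidableEq, Fintype

open Side

/-- The outward normals of the faces of the rotunda. -/
def Side.normal : Side → GoldenVec
  | base => ⟨⟨0, 0⟩, ⟨0, -1⟩, ⟨-1, 0⟩⟩
  | top => ⟨⟨0, 0⟩, ⟨0, 1⟩, ⟨1, 0⟩⟩
  | pent i => ![⟨⟨0, 1⟩, ⟨1, 0⟩, ⟨0, 0⟩⟩, ⟨⟨0, 0⟩, ⟨0, 1⟩, ⟨-1, 0⟩⟩, ⟨⟨0, -1⟩, ⟨1, 0⟩, ⟨0, 0⟩⟩,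
      ⟨⟨-1, 0⟩, ⟨0, 0⟩, ⟨0, 1⟩⟩, ⟨⟨1, 0⟩, ⟨0, 0⟩, ⟨0, 1⟩⟩] i
  | tri i => ![⟨⟨1, 0⟩, ⟨1, 0⟩, ⟨-1, 0⟩⟩, ⟨⟨-1, 0⟩, ⟨1, 0⟩, ⟨-1, 0⟩⟩, ⟨⟨0, -1⟩, ⟨0, 0⟩, ⟨-1, 1⟩⟩,
      ⟨⟨0, 0⟩, ⟨1, -1⟩, ⟨0, 1⟩⟩, ⟨⟨0, 1⟩, ⟨0, 0⟩, ⟨-1, 1⟩⟩] i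
  | up i => ![⟨⟨-1, 1⟩, ⟨0, 1⟩, ⟨0, 0⟩⟩, ⟨⟨1, -1⟩, ⟨0, 1⟩, ⟨0, 0⟩⟩, ⟨⟨-1, 0⟩, ⟨1, 0⟩, ⟨1, 0⟩⟩,
      ⟨⟨0, 0⟩, ⟨-1, 1⟩, ⟨0, 1⟩⟩, ⟨⟨1, 0⟩, ⟨1, 0⟩, ⟨1, 0⟩⟩] i

/-- A vertex of each face. -/
def Side.vert : Side → Vert
  | base => a 0
  | top => t 0
  | pent i => a i
  | tri i => b i
  | up i => m i

/-- The level of the plane of a face. -/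
def Side.level (f : Side) : GoldenInt := f.normal.dot (coord f.vert)

/-- Equality is kept apart from certified strict inequality: both alternatives are decidable in
ℤ[φ], and the later arguments need to know exactly which vertices lie on a face. -/
theorem Side.le_level : ∀ (f : Side) (k : Vert),
    f.normal.dot (coord k) = f.level ∨ (f.level - f.normal.dot (coord k)).IsPos := by
  decide +kernel

/-- The edges of the rotunda. -/
inductive Edge
  | ab (i : Fin 5)
  | ba (i : Fin 5)
  | bm (i : Fin 5)
  | ma (i : Fin 5)
  | mt (i : Fin 5)
  | mt' (i : Fin 5)
  | tt (i : Fin 5)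
deriving DecidableEq, Fintype

/-- The end points of an edge. -/
def Edge.ends : Edge → Vert × Vert
  | ab i => (a i, b i)
  | ba i => (b i, a (i + 1))
  | bm i => (b i, m i)
  | ma i => (m i, a (i + 1))
  | mt i => (m i, t i)
  | mt' i => (m i, t (i + 1))
  | tt i => (t i, t (i + 1))

/-- The two faces at an edge. -/
def Edge.sides : Edge → Side × Side
  | ab i => (base, pent i)
  | ba i => (base, tri i)
  | bm i => (pent i, tri i)
  | ma i => (pent (i + 1), tri i)
  | mt i => (pent i, up i)
  | mt' i => (pent (i + 1), up i)
  | tt i => (top, up i)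

/-- An edge with a direction. -/
abbrev Dart := Edge × Bool

/-- The start of a directed edge. -/
def Dart.src (d : Dart) : Vert := if d.2 then d.1.ends.1 else d.1.ends.2

/-- The end of a directed edge. -/
def Dart.tgt (d : Dart) : Vert := if d.2 then d.1.ends.2 else d.1.ends.1

/-- The directed edge with the opposite direction. -/
def Dart.rev (d : Dart) : Dart := (d.1, !d.2)

theorem Dart.src_rev (d : Dart) : d.rev.src = d.tgt := by
  obtain ⟨e, _ | _⟩ := d <;> rfl

theorem Dart.tgt_rev (d : Dart) : d.rev.tgt = d.src := by
  obtain ⟨e, _ | _⟩ := d <;> rfl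

/-- The edge lies in the face. -/
def Edge.OnSide (e : Edge) (f : Side) : Prop := e.sides.1 = f ∨ e.sides.2 = f

instance (e : Edge) (f : Side) : Decidable (e.OnSide f) := by
  unfold Edge.OnSide
  infer_instance

theorem Edge.onSide_iff : ∀ (e : Edge) (f : Side), e.OnSide f ↔
    f.normal.dot (coord e.ends.1) = f.level ∧ f.normal.dot (coord e.ends.2) = f.level := by
  decide +kernel

theorem Edge.eq_of_onSide : ∀ e e' : Edge, e'.OnSide e.sides.1 → e'.OnSide e.sides.2 → e = e' := by
  decide +kernel

/-! ### The cuts -/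

/-- The outward normals of the cuts. -/
def cutNormal : CutName → GoldenVec
  | cut1start i => coord (path i 0) - coord (path i 5)
  | cut1stop i => coord (path i 5) - coord (path i 0)
  | cut2 i => -(pent i).normal
  | cut3 i => -(tri (i + 2)).normal
  | cut4m i => coord (m i)
  | cut4t i => coord (t i)

/-- The vertices removed by a cut. -/
def removed : CutName → Finset Vert
  | cut1start i => {path i 0}
  | cut1stop i => {path i 5}
  | cut2 i => {b (i + 2), a (i + 3)}
  | cut3 i => {a i, b i}
  | cut4m i => {m i}
  | cut4t i => {t i}

/-- A vertex removed by a cut. -/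
def firstRemoved : CutName → Vert
  | cut1start i => path i 0
  | cut1stop i => path i 5
  | cut2 i => b (i + 2)
  | cut3 i => a i
  | cut4m i => m i
  | cut4t i => t i

theorem firstRemoved_mem : ∀ c, firstRemoved c ∈ removed c := by
  decide +kernel

/-- A vertex nearest to the plane of a cut among those which the cut does not remove. -/
def firstKept : CutName → Vert
  | cut1start i => m i
  | cut1stop i => m (i + 2)
  | cut2 i => m (i + 2)
  | cut3 i => m i
  | cut4m i => b i
  | cut4t i => m i

theorem firstKept_notMem : ∀ c, firstKept c ∉ removed c := by
  decide +kernel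

theorem inner_stdVert (u : GoldenVec) (k : Vert) :
    inner ℝ u.toE3 (stdVert k) = (u.dot (coord k)).toReal := by
  rw [stdVert_eq_coord, GoldenVec.inner_toE3]

theorem toE3_mem_orthogonal {S : Set Vert} {u : GoldenVec} {c : GoldenInt}
    (hu : ∀ k ∈ S, u.dot (coord k) = c) : u.toE3 ∈ (vectorSpan ℝ (stdVert '' S))ᗮ := by
  have h : vectorSpan ℝ (stdVert '' S) ≤ (ℝ ∙ u.toE3)ᗮ := by
    refine Submodule.span_le.2 ?_
    rintro _ ⟨_, ⟨k, hk, rfl⟩, _, ⟨l, hl, rfl⟩, rfl⟩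
    rw [SetLike.mem_coe, Submodule.mem_orthogonal_singleton_iff_inner_right]
    exact (inner_sub_right _ _ _).trans
      (by rw [inner_stdVert, inner_stdVert, hu k hk, hu l hl, sub_self])
  rw [Submodule.mem_orthogonal]
  intro x hx
  rw [real_inner_comm]
  exact Submodule.mem_orthogonal_singleton_iff_inner_right.1 (h hx)

theorem inner_eq_zero_of_mem_vectorSpan {S : Set Vert} {u : GoldenVec} {c : GoldenInt} {n : E3}
    (hu : ∀ k ∈ S, u.dot (coord k) = c) (hn : n ∈ vectorSpan ℝ (stdVert '' S)) :
    inner ℝ u.toE3 n = 0 := by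
  rw [real_inner_comm]
  exact (Submodule.mem_orthogonal _ _).1 (toE3_mem_orthogonal hu) n hn

theorem inner_eq_zero_of_mem_orthogonal {S : Set Vert} {n : E3} {k l : Vert} (hk : k ∈ S)
    (hl : l ∈ S) (hn : n ∈ (vectorSpan ℝ (stdVert '' S))ᗮ) :
    inner ℝ (coord k - coord l).toE3 n = 0 := by
  rw [GoldenVec.toE3_sub, ← stdVert_eq_coord, ← stdVert_eq_coord]
  exact (Submodule.mem_orthogonal _ _).1 hn _
    (vsub_mem_vectorSpan ℝ ⟨k, hk, rfl⟩ ⟨l, hl, rfl⟩)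

/-- A normal of the plane of a path. -/
def pathNormal (i : Fin 5) : GoldenVec :=
  (coord (path i 0) - coord (path i 5)).cross (coord (path i 1) - coord (path i 5))

theorem pathNormal_dot : ∀ i, ∀ k ∈ Set.range (path i),
    (pathNormal i).dot (coord k) = (pathNormal i).dot (coord (path i 0)) := by
  have h : ∀ i j, (pathNormal i).dot (coord (path i j)) = (pathNormal i).dot (coord (path i 0)) := by
    decide +kernel
  rintro i _ ⟨j, rfl⟩
  exact h i j

theorem baseNormal_dot : ∀ k ∈ baseFace, base.normal.dot (coord k) = base.level := by
  rintro _ (⟨i, rfl⟩ | ⟨i, rfl⟩) <;> revert i <;> decide +kernel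

theorem pentNormal_dot (i : Fin 5) :
    ∀ k ∈ pentagon i, (-(pent i).normal).dot (coord k) = (-(pent i).normal).dot (coord (a i)) := by
  simp only [pentagon, Set.mem_insert_iff, Set.mem_singleton_iff, forall_eq_or_imp, forall_eq]
  revert i
  decide +kernel

theorem triNormal_dot (i : Fin 5) :
    ∀ k ∈ triangle i, (-(tri i).normal).dot (coord k) = (-(tri i).normal).dot (coord (b i)) := by
  simp only [triangle, Set.mem_insert_iff, Set.mem_singleton_iff, forall_eq_or_imp, forall_eq]
  revert i
  decide +kernel

/-- The other conditions fix the normal of a cut only up to a scalar; comparing a removed vertex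
with a kept one fixes its sign. -/
theorem cutNormal_gap : ∀ c,
    ((cutNormal c).dot (coord (firstRemoved c)) - (cutNormal c).dot (coord (firstKept c))).IsPos := by
  decide +kernel

theorem IsCut.removes {v : Vert → E3} {h : HalfSpace} {c : CutName} (hc : IsCut v h c) :
    Removes v h (removed c) := by
  cases c <;> simp only [removed, Finset.coe_singleton, Finset.coe_pair]
  exacts [hc.2.2, hc.2.2, hc.2, hc.2, hc.2, hc.2]

/-- Let e j be the edge vectors at the vertex and let the corners be at the fractions s j along
them. The neighbours form a parallelogram, so e 0 + e 2 = e 1 + e 3. The corners form one too, which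
gives (s 1 - s 0) e 1 + (s 0 - s 2) e 2 + (s 3 - s 0) e 3 = 0. Independence makes all s j equal, so
the cutting plane is parallel to the plane of the four neighbours. -/
theorem CutsRectangle.inner_eq_zero {h : HalfSpace} {k : Vert} {w : Fin 4 → Vert}
    (hr : CutsRectangle stdVert h k w)
    (hw : coord (w 0) + coord (w 2) = coord (w 1) + coord (w 3))
    (hdet : (GoldenVec.det (coord (w 1) - coord k) (coord (w 2) - coord k) (coord (w 3) - coord k) *
      GoldenVec.det (coord (w 1) - coord k) (coord (w 2) - coord k) (coord (w 3) - coord k)).IsPos) :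
    inner ℝ (coord (w 1) - coord (w 0)).toE3 h.normal = 0 ∧
      inner ℝ (coord (w 3) - coord (w 0)).toE3 h.normal = 0 := by
  obtain ⟨q, hq, hq1, -, hne, -⟩ := hr
  have hs : ∀ j, ∃ s : ℝ, q j = (coord k).toE3 + s • (coord (w j) - coord k).toE3 := by
    intro j
    have := (hq j).1
    rw [segment_eq_image'] at this
    obtain ⟨s, -, hs⟩ := this
    exact ⟨s, by rw [← hs, GoldenVec.toE3_sub, stdVert_eq_coord, stdVert_eq_coord]⟩
  choose s hs using hs
  have hw' : (coord (w 0)).toE3 = (coord (w 1)).toE3 + (coord (w 3)).toE3 - (coord (w 2)).toE3 := by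
    rw [eq_sub_iff_add_eq, ← GoldenVec.toE3_add, hw, GoldenVec.toE3_add]
  have hdet' : (GoldenVec.det (coord (w 1) - coord k) (coord (w 2) - coord k)
      (coord (w 3) - coord k)).toReal ≠ 0 := fun h0 => by
    have := hdet.toReal_pos
    rw [GoldenInt.toReal_mul, h0, mul_zero] at this
    exact this.false
  obtain ⟨h1, h2, h3⟩ := GoldenVec.coeff_eq_zero (a := s 1 - s 0) (b := s 0 - s 2)
    (c := s 3 - s 0) hdet' (by
      rw [← sub_eq_zero] at hq1
      rw [← hq1, hs 0, hs 1, hs 2, hs 3]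
      simp only [GoldenVec.toE3_sub, hw']
      module)
  have h01 : ∀ j, s j = s 0 → s 0 * inner ℝ (coord (w j) - coord (w 0)).toE3 h.normal = 0 := by
    intro j hj
    have hd : q j - q 0 = s 0 • (coord (w j) - coord (w 0)).toE3 := by
      rw [hs j, hs 0, hj]
      simp only [GoldenVec.toE3_sub]
      module
    rw [real_inner_comm, ← inner_smul_right, ← hd, inner_sub_right, (hq j).2, (hq 0).2, sub_self]
  have hs0 : s 0 ≠ 0 := fun h0 => hne (by
    rw [hs 1, hs 0, sub_eq_zero.1 h1, h0, zero_smul, zero_smul])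
  exact ⟨(mul_eq_zero.1 (h01 1 (sub_eq_zero.1 h1))).resolve_left hs0,
    (mul_eq_zero.1 (h01 3 (sub_eq_zero.1 h3))).resolve_left hs0⟩

/-- The direction of each cut is determined by its name. -/
theorem IsCut.exists_normal_eq {h : HalfSpace} {c : CutName} (hc : IsCut stdVert h c) :
    ∃ r : ℝ, 0 < r ∧ h.normal = r • (cutNormal c).toE3 := by
  have hlt : inner ℝ h.normal (coord (firstKept c)).toE3 <
      inner ℝ h.normal (coord (firstRemoved c)).toE3 := by
    rw [← stdVert_eq_coord, ← stdVert_eq_coord]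
    exact (hc.removes.2 _ (firstKept_notMem c)).trans (hc.removes.1 _ (firstRemoved_mem c))
  have hgap := cutNormal_gap c
  cases c with
  | cut1start i =>
    refine GoldenVec.exists_pos_smul (inner_eq_zero_of_mem_vectorSpan baseNormal_dot hc.1)
      (inner_eq_zero_of_mem_vectorSpan (pathNormal_dot i) hc.2.1) ?_ ?_ ?_ hgap hlt <;>
    · clear hlt hgap hc
      revert i
      decide +kernel
  | cut1stop i =>
    refine GoldenVec.exists_pos_smul (inner_eq_zero_of_mem_vectorSpan baseNormal_dot hc.1)
      (inner_eq_zero_of_mem_vectorSpan (pathNormal_dot i) hc.2.1) ?_ ?_ ?_ hgap hlt <;>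
    · clear hlt hgap hc
      revert i
      decide +kernel
  | cut2 i =>
    refine GoldenVec.exists_pos_smul
      (inner_eq_zero_of_mem_orthogonal (k := b i) (l := a i) (by simp [pentagon])
        (by simp [pentagon]) hc.1)
      (inner_eq_zero_of_mem_orthogonal (k := m i) (l := a i) (by simp [pentagon])
        (by simp [pentagon]) hc.1) ?_ ?_ ?_ hgap hlt <;>
    · clear hlt hgap hc
      revert i
      decide +kernel
  | cut3 i =>
    refine GoldenVec.exists_pos_smul
      (inner_eq_zero_of_mem_orthogonal (k := b (i + 2)) (l := a (i + 2 + 1)) (by simp [triangle])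
        (by simp [triangle]) hc.1)
      (inner_eq_zero_of_mem_orthogonal (k := m (i + 2)) (l := a (i + 2 + 1)) (by simp [triangle])
        (by simp [triangle]) hc.1) ?_ ?_ ?_ hgap hlt <;>
    · clear hlt hgap hc
      revert i
      decide +kernel
  | cut4m i =>
    have hr := hc.1.inner_eq_zero (by clear hlt hgap hc; revert i; decide +kernel)
      (by clear hlt hgap hc; revert i; decide +kernel)
    refine GoldenVec.exists_pos_smul hr.1 hr.2 ?_ ?_ ?_ hgap hlt <;>
    · clear hr hlt hgap hc
      revert i
      decide +kernel
  | cut4t i =>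
    have hr := hc.1.inner_eq_zero (by clear hlt hgap hc; revert i; decide +kernel)
      (by clear hlt hgap hc; revert i; decide +kernel)
    refine GoldenVec.exists_pos_smul hr.1 hr.2 ?_ ?_ ?_ hgap hlt <;>
    · clear hr hlt hgap hc
      revert i
      decide +kernel

/-! ### Existence of the cuts -/

theorem cutNormal_dot_removed : ∀ c, ∀ k ∈ removed c,
    (cutNormal c).dot (coord k) = (cutNormal c).dot (coord (firstRemoved c)) := by
  decide +kernel

theorem cutNormal_dot_kept : ∀ c, ∀ k ∉ removed c,
    (cutNormal c).dot (coord k) = (cutNormal c).dot (coord (firstKept c)) ∨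
      ((cutNormal c).dot (coord (firstKept c)) - (cutNormal c).dot (coord k)).IsPos := by
  decide +kernel

/-- The largest value of the normal of a cut at a vertex. -/
noncomputable def maxRemoved (c : CutName) : ℝ := ((cutNormal c).dot (coord (firstRemoved c))).toReal

/-- The largest value of the normal of a cut at a vertex that is not removed. -/
noncomputable def maxKept (c : CutName) : ℝ := ((cutNormal c).dot (coord (firstKept c))).toReal

theorem maxKept_lt (c : CutName) : maxKept c < maxRemoved c := by
  have := (cutNormal_gap c).toReal_pos
  rwa [GoldenInt.toReal_sub, sub_pos] at this

theorem inner_removed {c : CutName} {k : Vert} (hk : k ∈ removed c) :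
    inner ℝ (cutNormal c).toE3 (stdVert k) = maxRemoved c := by
  rw [inner_stdVert, cutNormal_dot_removed c k hk, maxRemoved]

theorem inner_kept_le {c : CutName} {k : Vert} (hk : k ∉ removed c) :
    inner ℝ (cutNormal c).toE3 (stdVert k) ≤ maxKept c := by
  rw [inner_stdVert, maxKept]
  rcases cutNormal_dot_kept c k hk with h | h
  · rw [h]
  · have := h.toReal_pos
    rw [GoldenInt.toReal_sub] at this
    linarith

/-- A cut of moderate depth. -/
noncomputable def standardCut (c : CutName) : HalfSpace where
  normal := (cutNormal c).toE3
  normal_ne_zero h := by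
    have h1 := inner_removed (firstRemoved_mem c)
    have h2 := inner_kept_le (firstKept_notMem c)
    have h3 := maxKept_lt c
    rw [h, inner_zero_left] at h1 h2
    linarith
  level := (2 * maxRemoved c + maxKept c) / 3

theorem removes_standardCut (c : CutName) : Removes stdVert (standardCut c) (removed c) := by
  have h := maxKept_lt c
  refine ⟨fun k hk => ?_, fun k hk => ?_⟩
  · have := inner_removed hk
    simp only [standardCut]
    linarith
  · have := inner_kept_le hk
    simp only [standardCut]
    linarith

/-- The four neighbours lie at the same level and form a rectangle, and the standard cut meets the
edges one third of the way to them. The corners thus form a copy of that rectangle scaled by 1/3. -/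
theorem cutsRectangle_standardCut {c : CutName} {k : Vert} {w : Fin 4 → Vert}
    (hk : k ∈ removed c)
    (hw : ∀ j, (cutNormal c).dot (coord (w j)) = (cutNormal c).dot (coord (firstKept c)))
    (h1 : coord (w 1) - coord (w 0) = coord (w 2) - coord (w 3))
    (h2 : (coord (w 1) - coord (w 0)).dot (coord (w 3) - coord (w 0)) = 0)
    (h3 : ((coord (w 1) - coord (w 0)).dot (coord (w 1) - coord (w 0))).IsPos)
    (h4 : ((coord (w 3) - coord (w 0)).dot (coord (w 3) - coord (w 0))).IsPos) :
    CutsRectangle stdVert (standardCut c) k w := by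
  set q : Fin 4 → E3 := fun j => stdVert k + (1 / 3 : ℝ) • (stdVert (w j) - stdVert k) with hq
  have hsub : ∀ i j, q i - q j = (1 / 3 : ℝ) • (coord (w i) - coord (w j)).toE3 := by
    intro i j
    simp only [hq, GoldenVec.toE3_sub, ← stdVert_eq_coord]
    module
  have hne : ∀ i j, ((coord (w i) - coord (w j)).dot (coord (w i) - coord (w j))).IsPos →
      q i ≠ q j := by
    intro i j hij h0
    rw [← sub_eq_zero, hsub, smul_eq_zero_iff_right (by norm_num)] at h0
    have := hij.toReal_pos
    rw [← GoldenVec.inner_toE3, h0, inner_zero_left] at this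
    exact this.false
  refine ⟨q, fun j => ⟨?_, ?_⟩, ?_, ?_, hne 1 0 h3, hne 3 0 h4⟩
  · rw [segment_eq_image']
    exact ⟨1 / 3, by norm_num, rfl⟩
  · have e1 := inner_removed hk
    have e2 := inner_stdVert (cutNormal c) (w j)
    rw [hw j] at e2
    change inner ℝ (cutNormal c).toE3 (q j) = (2 * maxRemoved c + maxKept c) / 3
    simp only [hq]
    rw [inner_add_right, inner_smul_right, inner_sub_right, e1, e2, maxKept]
    ring
  · rw [hsub, hsub, h1]
  · rw [hsub, hsub, inner_smul_left, inner_smul_right, GoldenVec.inner_toE3, h2,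
      GoldenInt.toReal_zero, mul_zero, mul_zero]

theorem isCut_standardCut (c : CutName) : IsCut stdVert (standardCut c) c := by
  have hr := removes_standardCut c
  have hpath : ∀ i,
      (standardCut (cut1start i)).normal = stdVert (path i 0) -ᵥ stdVert (path i 5) ∧
      (standardCut (cut1stop i)).normal = stdVert (path i 5) -ᵥ stdVert (path i 0) := fun i => by
    simp only [standardCut, cutNormal, GoldenVec.toE3_sub, ← stdVert_eq_coord, vsub_eq_sub, and_self]
  have hb0 : ∀ i, path i 0 ∈ baseFace := fun i => Or.inr ⟨i, rfl⟩
  have hb5 : ∀ i, path i 5 ∈ baseFace := fun i => Or.inl ⟨i + 3, rfl⟩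
  cases c with
  | cut1start i =>
    simp only [removed, Finset.coe_singleton] at hr
    refine ⟨?_, ?_, hr⟩ <;> unfold PerpendicularTo <;> rw [(hpath i).1]
    · exact vsub_mem_vectorSpan ℝ ⟨_, hb0 i, rfl⟩ ⟨_, hb5 i, rfl⟩
    · exact vsub_mem_vectorSpan ℝ ⟨_, ⟨0, rfl⟩, rfl⟩ ⟨_, ⟨5, rfl⟩, rfl⟩
  | cut1stop i =>
    simp only [removed, Finset.coe_singleton] at hr
    refine ⟨?_, ?_, hr⟩ <;> unfold PerpendicularTo <;> rw [(hpath i).2]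
    · exact vsub_mem_vectorSpan ℝ ⟨_, hb5 i, rfl⟩ ⟨_, hb0 i, rfl⟩
    · exact vsub_mem_vectorSpan ℝ ⟨_, ⟨5, rfl⟩, rfl⟩ ⟨_, ⟨0, rfl⟩, rfl⟩
  | cut2 i =>
    simp only [removed, Finset.coe_pair] at hr
    exact ⟨toE3_mem_orthogonal (pentNormal_dot i), hr⟩
  | cut3 i =>
    simp only [removed, Finset.coe_pair] at hr
    exact ⟨toE3_mem_orthogonal (triNormal_dot (i + 2)), hr⟩
  | cut4m i =>
    simp only [removed, Finset.coe_singleton] at hr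
    refine ⟨cutsRectangle_standardCut (by simp [removed]) ?_ ?_ ?_ ?_ ?_, hr⟩ <;>
    · clear hr
      revert i
      decide +kernel
  | cut4t i =>
    simp only [removed, Finset.coe_singleton] at hr
    refine ⟨cutsRectangle_standardCut (by simp [removed]) ?_ ?_ ?_ ?_ ?_, hr⟩ <;>
    · clear hr
      revert i
      decide +kernel

/-- Rescale each cut functional to be 1 at its removed vertices and at most 0 at the others. No
vertex is removed by both cuts, so the sum of the two is at most 1 on the rotunda, whereas on a
common point of the two pieces each would be at least 2/3. The functional `n` is this sum with
denominators cleared. -/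
theorem disjoint_standardCut {c c' : CutName} (h : Disjoint (removed c) (removed c')) :
    Disjoint (solid stdVert ∩ (standardCut c).coCarrier)
      (solid stdVert ∩ (standardCut c').coCarrier) := by
  have hc := sub_pos.2 (maxKept_lt c)
  have hc' := sub_pos.2 (maxKept_lt c')
  set A := maxRemoved c - maxKept c with hA
  set B := maxRemoved c' - maxKept c' with hB
  set n : E3 := B • (cutNormal c).toE3 + A • (cutNormal c').toE3 with hn
  have hle : ∀ d, ∀ k, inner ℝ (cutNormal d).toE3 (stdVert k) ≤ maxRemoved d := fun d k => by
    by_cases hk : k ∈ removed d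
    · exact (inner_removed hk).le
    · exact (inner_kept_le hk).trans (maxKept_lt d).le
  have hsub : solid stdVert ⊆ {x | inner ℝ n x ≤ B * maxKept c + A * maxKept c' + A * B} := by
    refine convexHull_min ?_ (convex_halfSpace_le (innerₛₗ ℝ n).isLinear _)
    rintro _ ⟨k, rfl⟩
    rw [Set.mem_ofPred_eq, hn, inner_add_left, inner_smul_left, inner_smul_left]
    simp only [conj_trivial]
    by_cases hk : k ∈ removed c
    · have h1 := hle c k
      have h2 := inner_kept_le (Finset.disjoint_left.1 h hk)
      nlinarith
    · have h1 := inner_kept_le hk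
      have h2 := hle c' k
      nlinarith
  refine Set.disjoint_left.2 ?_
  rintro x ⟨hx, h1⟩ ⟨-, h2⟩
  have h3 := hsub hx
  rw [Set.mem_ofPred_eq, hn, inner_add_left, inner_smul_left, inner_smul_left] at h3
  simp only [conj_trivial] at h3
  change (2 * maxRemoved c + maxKept c) / 3 ≤ inner ℝ (cutNormal c).toE3 x at h1
  change (2 * maxRemoved c' + maxKept c') / 3 ≤ inner ℝ (cutNormal c').toE3 x at h2
  have h4 := mul_le_mul_of_nonneg_left h1 hc'.le
  have h5 := mul_le_mul_of_nonneg_left h2 hc.le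
  have h6 := mul_pos hc hc'
  have e1 : maxRemoved c = A + maxKept c := by rw [hA]; ring
  have e2 : maxRemoved c' = B + maxKept c' := by rw [hB]; ring
  rw [e1] at h4
  rw [e2] at h5
  nlinarith

/-! ### Truncated rotundas as simple polytopes -/

theorem inner_side_le (f : Side) (k : Vert) :
    inner ℝ f.normal.toE3 (stdVert k) ≤ f.level.toReal := by
  rw [inner_stdVert]
  rcases f.le_level k with h | h
  · rw [h]
  · have := h.toReal_pos
    rw [GoldenInt.toReal_sub] at this
    linarith

theorem inner_side_eq_iff (f : Side) (k : Vert) :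
    inner ℝ f.normal.toE3 (stdVert k) = f.level.toReal ↔ f.normal.dot (coord k) = f.level := by
  rw [inner_stdVert]
  refine ⟨fun h => ?_, fun h => by rw [h]⟩
  refine (f.le_level k).resolve_right fun h' => ?_
  have := h'.toReal_pos
  rw [GoldenInt.toReal_sub, h, sub_self] at this
  exact this.false

theorem Dart.onSide_iff (d : Dart) (f : Side) : d.1.OnSide f ↔
    inner ℝ f.normal.toE3 (stdVert d.src) = f.level.toReal ∧
      inner ℝ f.normal.toE3 (stdVert d.tgt) = f.level.toReal := by
  rw [inner_side_eq_iff, inner_side_eq_iff, Edge.onSide_iff]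
  obtain ⟨e, _ | _⟩ := d
  · exact and_comm
  · exact Iff.rfl

/-- Every vertex `p` is removed by exactly one cut `κ p` of a system of cuts, and the truncation
has one vertex for each directed edge whose ends are removed by different cuts. -/
structure IsCutSystem (κ : Vert → CutName) : Prop where
  mem_removed_iff : ∀ p q, q ∈ removed (κ p) ↔ κ q = κ p
  exists_nbr : ∀ d : Dart, κ d.src ≠ κ d.tgt →
    (∃ d' : Dart, κ d'.src ≠ κ d'.tgt ∧ κ d'.src = κ d.src ∧ d'.1.OnSide d.1.sides.1 ∧
      ¬d'.1.OnSide d.1.sides.2) ∧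
    ∃ d' : Dart, κ d'.src ≠ κ d'.tgt ∧ κ d'.src = κ d.src ∧ d'.1.OnSide d.1.sides.2 ∧
      ¬d'.1.OnSide d.1.sides.1
  exists_dart_of_vert : ∀ p, ∃ d : Dart, κ d.src ≠ κ d.tgt ∧ κ d.src = κ p
  exists_dart_of_side : ∀ f, ∃ d : Dart, κ d.src ≠ κ d.tgt ∧ d.1.OnSide f

/-- The directed edges whose start and end are removed by different cuts. -/
abbrev CutDart (κ : Vert → CutName) : Type := {d : Dart // κ d.src ≠ κ d.tgt}

/-- The three facets of a truncation at the vertex on a directed edge. -/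
def CutDart.facets {κ : Vert → CutName} (d : CutDart κ) : Fin 3 → Side ⊕ Set.range κ :=
  ![Sum.inr ⟨κ d.1.src, d.1.src, rfl⟩, Sum.inl d.1.1.sides.1, Sum.inl d.1.1.sides.2]

theorem CutDart.exists_facets_eq_inl {κ : Vert → CutName} (d : CutDart κ) (f : Side) :
    (∃ i, d.facets i = Sum.inl f) ↔ d.1.1.OnSide f := by
  simp [CutDart.facets, Fin.exists_fin_succ, Edge.OnSide]

theorem CutDart.exists_facets_eq_inr {κ : Vert → CutName} (d : CutDart κ) (c : Set.range κ) :
    (∃ i, d.facets i = Sum.inr c) ↔ κ d.1.src = c := by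
  simp [CutDart.facets, Fin.exists_fin_succ, Subtype.ext_iff]

/-- Cutting planes in the standard position, with disjoint pieces, for a system of cuts. -/
structure CutPlanes (κ : Vert → CutName) where
  /-- The half-spaces that are kept. -/
  half : CutName → HalfSpace
  isCut : ∀ p, IsCut stdVert (half (κ p)) (κ p)
  disjoint : (Set.range κ).PairwiseDisjoint fun c => solid stdVert ∩ (half c).coCarrier

namespace CutPlanes

variable {κ : Vert → CutName} (hκ : IsCutSystem κ) (h : CutPlanes κ)

include hκ in
theorem exists_point (d : CutDart κ) : ∃ x ∈ openSegment ℝ (stdVert d.1.src) (stdVert d.1.tgt),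
    inner ℝ (h.half (κ d.1.src)).normal x = (h.half (κ d.1.src)).level := by
  have hr := (h.isCut d.1.src).removes
  have h1 := hr.1 d.1.src (by simp [hκ.mem_removed_iff])
  have h2 := hr.2 d.1.tgt (by simpa [hκ.mem_removed_iff] using d.2.symm)
  set L := (h.half (κ d.1.src)).level
  set n := (h.half (κ d.1.src)).normal
  set A := inner ℝ n (stdVert d.1.src)
  set B := inner ℝ n (stdVert d.1.tgt)
  have hAB : 0 < A - B := by linarith
  refine ⟨((L - B) / (A - B)) • stdVert d.1.src + ((A - L) / (A - B)) • stdVert d.1.tgt,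
    ⟨_, _, div_pos (by linarith) hAB, div_pos (by linarith) hAB, ?_, rfl⟩, ?_⟩
  · rw [← add_div, div_eq_one_iff_eq hAB.ne']
    ring
  · rw [inner_add_right, inner_smul_right, inner_smul_right]
    change (L - B) / (A - B) * A + (A - L) / (A - B) * B = L
    field_simp
    ring

/-- The vertex of the truncation on a directed edge. -/
noncomputable def point (d : CutDart κ) : E3 := (exists_point hκ h d).choose

theorem point_mem_openSegment (d : CutDart κ) :
    point hκ h d ∈ openSegment ℝ (stdVert d.1.src) (stdVert d.1.tgt) :=
  (exists_point hκ h d).choose_spec.1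

theorem inner_point (d : CutDart κ) :
    inner ℝ (h.half (κ d.1.src)).normal (point hκ h d) = (h.half (κ d.1.src)).level :=
  (exists_point hκ h d).choose_spec.2

theorem point_mem_solid (d : CutDart κ) : point hκ h d ∈ solid stdVert :=
  (convex_convexHull ℝ (Set.range stdVert)).openSegment_subset
    (subset_convexHull ℝ _ ⟨_, rfl⟩) (subset_convexHull ℝ _ ⟨_, rfl⟩)
    (point_mem_openSegment hκ h d)

/-- The point lies on the plane of its own cut, hence in the closed piece removed there, and this
piece is disjoint from all the others. -/
theorem inner_point_lt (d : CutDart κ) {c : CutName} (hc : c ∈ Set.range κ) (hne : κ d.1.src ≠ c) :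
    inner ℝ (h.half c).normal (point hκ h d) < (h.half c).level := by
  by_contra hlt
  exact Set.disjoint_left.1 (h.disjoint ⟨_, rfl⟩ hc hne)
    ⟨point_mem_solid hκ h d, (inner_point hκ h d).ge⟩ ⟨point_mem_solid hκ h d, not_lt.1 hlt⟩

theorem inner_side_point (d : CutDart κ) (f : Side) :
    inner ℝ f.normal.toE3 (point hκ h d) ≤ f.level.toReal ∧
      (inner ℝ f.normal.toE3 (point hκ h d) = f.level.toReal ↔ d.1.1.OnSide f) := by
  obtain ⟨s, t, hs, ht, hst, hx⟩ := point_mem_openSegment hκ h d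
  rw [Dart.onSide_iff, ← hx, inner_add_right, inner_smul_right, inner_smul_right]
  have h1 := inner_side_le f d.1.src
  have h2 := inner_side_le f d.1.tgt
  set A := inner ℝ f.normal.toE3 (stdVert d.1.src)
  set B := inner ℝ f.normal.toE3 (stdVert d.1.tgt)
  set L := f.level.toReal
  have hs' := mul_nonneg hs.le (sub_nonneg.2 h1)
  have ht' := mul_nonneg ht.le (sub_nonneg.2 h2)
  have hL : L = s * L + t * L := by rw [← add_mul, hst, one_mul]
  refine ⟨by linarith, fun hEq => ?_, fun ⟨hA, hB⟩ => by rw [hA, hB, ← hL]⟩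
  have h3 : s * (L - A) = 0 := by linarith
  have h4 : t * (L - B) = 0 := by linarith
  exact ⟨by linarith [(mul_eq_zero.1 h3).resolve_left hs.ne'],
    by linarith [(mul_eq_zero.1 h4).resolve_left ht.ne']⟩

/-- The truncation as a simple polytope. -/
noncomputable def polytope : SimplePolytope (Side ⊕ Set.range κ) (CutDart κ) where
  normal := Sum.elim (fun f => f.normal.toE3) fun c => (h.half c).normal
  level := Sum.elim (fun f => f.level.toReal) fun c => (h.half c).level
  point := point hκ h
  facets := CutDart.facets
  le d i := by
    rcases i with f | c
    · exact (inner_side_point hκ h d f).1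
    · by_cases hc : κ d.1.src = c
      · simp only [Sum.elim_inr, ← hc]
        exact (inner_point hκ h d).le
      · exact (inner_point_lt hκ h d c.2 hc).le
  eq_iff d i := by
    rcases i with f | c
    · rw [CutDart.exists_facets_eq_inl]
      exact (inner_side_point hκ h d f).2
    · rw [CutDart.exists_facets_eq_inr]
      refine ⟨fun hEq => ?_, fun hc => ?_⟩
      · by_contra hc
        exact (inner_point_lt hκ h d c.2 hc).ne hEq
      · simp only [Sum.elim_inr, ← hc]
        exact inner_point hκ h d
  exists_nbr d i := by
    obtain ⟨⟨d₁, hd₁, hs₁, hf₁, hg₁⟩, d₂, hd₂, hs₂, hf₂, hg₂⟩ := hκ.exists_nbr d.1 d.2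
    have key : ∀ w : CutDart κ, ∀ j, (∃ k, w.facets k = d.facets j) ↔
        ![κ w.1.src = κ d.1.src, w.1.1.OnSide d.1.1.sides.1, w.1.1.OnSide d.1.1.sides.2] j := by
      intro w j
      fin_cases j
      · exact w.exists_facets_eq_inr _
      · exact w.exists_facets_eq_inl _
      · exact w.exists_facets_eq_inl _
    have hrev : κ d.1.rev.src ≠ κ d.1.rev.tgt := by
      rw [Dart.src_rev, Dart.tgt_rev]
      exact d.2.symm
    simp only [key, Fin.forall_fin_succ]
    -- Leaving the plane of the cut leads along the old edge to the vertex at its other end. Leaving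
    -- one of the two old faces leads along the other face within the same cut, to `d₂` or `d₁`.
    fin_cases i
    · refine ⟨⟨d.1.rev, hrev⟩, ?_⟩
      have h1 : d.1.rev.1 = d.1.1 := rfl
      simp [Dart.src_rev, d.2.symm, h1, Edge.OnSide]
    · refine ⟨⟨d₂, hd₂⟩, ?_⟩
      simp [hs₂, hf₂, hg₂]
    · refine ⟨⟨d₁, hd₁⟩, ?_⟩
      simp [hs₁, hf₁, hg₁]
  eq_of_facets d d' hdd' := by
    have h0 := (d'.exists_facets_eq_inr _).1 (hdd' 0)
    have h1 := (d'.exists_facets_eq_inl _).1 (hdd' 1)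
    have h2 := (d'.exists_facets_eq_inl _).1 (hdd' 2)
    have he := Edge.eq_of_onSide _ _ h1 h2
    refine Subtype.ext (Prod.ext he ?_)
    by_contra hne
    -- The two old faces determine the edge; its direction is determined by the cut, because the two
    -- ends are removed by different cuts.
    have hrev : d'.1 = d.1.rev :=
      Prod.ext he.symm (by rw [Dart.rev]; exact Bool.eq_not.2 (Ne.symm hne))
    rw [hrev, Dart.src_rev] at h0
    exact d.2 h0.symm
  exists_vertex i := by
    rcases i with f | ⟨_, p, rfl⟩
    · obtain ⟨d, hd, hf⟩ := hκ.exists_dart_of_side f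
      exact ⟨⟨d, hd⟩, (CutDart.exists_facets_eq_inl ⟨d, hd⟩ f).2 hf⟩
    · obtain ⟨d, hd, hp⟩ := hκ.exists_dart_of_vert p
      exact ⟨⟨d, hd⟩, (CutDart.exists_facets_eq_inr ⟨d, hd⟩ ⟨_, p, rfl⟩).2 hp⟩

include hκ in
theorem nonempty_cutDart : Nonempty (CutDart κ) := by
  obtain ⟨d, hd, -⟩ := hκ.exists_dart_of_side base
  exact ⟨d, hd⟩

/-- The half-spaces of the faces are not shown separately to bound the rotunda: the body is the hull
of its vertices, and these lie on edges of the rotunda. -/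
theorem body_polytope : (polytope hκ h).body =
    solid stdVert ∩ ⋂ c ∈ Set.range κ, (h.half c).carrier := by
  have := nonempty_cutDart hκ
  refine Set.Subset.antisymm (fun x hx => ⟨?_, ?_⟩) ?_
  · rw [SimplePolytope.body_eq_convexHull] at hx
    refine convexHull_min ?_ (convex_convexHull ℝ _) hx
    rintro _ ⟨d, rfl⟩
    exact point_mem_solid hκ h d
  · exact Set.mem_iInter₂.2 fun c hc => hx (Sum.inr ⟨c, hc⟩)
  · rintro x ⟨hx, hxc⟩ (f | c)
    · have hsub : solid stdVert ⊆ {x | inner ℝ f.normal.toE3 x ≤ f.level.toReal} := by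
        refine convexHull_min ?_ (convex_halfSpace_le (innerₛₗ ℝ f.normal.toE3).isLinear _)
        rintro _ ⟨k, rfl⟩
        exact inner_side_le f k
      exact hsub hx
    · exact Set.mem_iInter₂.1 hxc c c.2

end CutPlanes

/-! ### Half-turns of normals -/

open Classical in
/-- Whether the inner product with `u` changes its sign between two vectors: `1` if so, else `0`. -/
noncomputable def signChange (u : E3) (p q : GoldenVec) : ℕ :=
  if (0 < inner ℝ p.toE3 u ↔ 0 < inner ℝ q.toE3 u) then 0 else 1

theorem signChange_comm (u : E3) (p q : GoldenVec) : signChange u p q = signChange u q p := by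
  simp only [signChange, iff_comm]

/-- A sufficient condition for a positive multiple of `q` to be a combination of `p` and `r` with
positive coefficients, unless `p` and `r` are opposite. -/
def IsBetween (p q r : GoldenVec) : Prop :=
  r = -p ∨ ((q.det r (p.cross q)).IsPos ∧ (p.det r (p.cross q)).IsPos ∧
    (p.det q (p.cross q)).IsPos ∧
    p.det r (p.cross q) • q = q.det r (p.cross q) • p + p.det q (p.cross q) • r)

instance (p q r : GoldenVec) : Decidable (IsBetween p q r) := by
  unfold IsBetween
  infer_instance

/-- If p and r have the same sign on u, then so does a positive combination q of them; if their
signs differ, q agrees with exactly one of the two. The latter case includes r = -p, where q is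
arbitrary. -/
theorem IsBetween.signChange_add {u : E3} {p q r : GoldenVec} (h : IsBetween p q r)
    (hp : inner ℝ p.toE3 u ≠ 0) :
    signChange u p q + signChange u q r = signChange u p r := by
  simp only [signChange]
  rcases h with rfl | ⟨h1, h2, h3, h4⟩
  · have hneg : inner ℝ (-p).toE3 u = -inner ℝ p.toE3 u := by
      rw [GoldenVec.toE3_neg, inner_neg_left]
    rw [hneg]
    rcases hp.lt_or_gt with hp | hp
    · simp only [hp.not_gt, neg_pos.2 hp]
      split_ifs <;> simp_all
    · simp only [hp, neg_pos, hp.not_gt]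
      split_ifs <;> simp_all
  · have h1 := h1.toReal_pos
    have h2 := h2.toReal_pos
    have h3 := h3.toReal_pos
    have h5 := congrArg (fun w : GoldenVec => inner ℝ w.toE3 u) h4
    simp only [GoldenVec.toE3_add, GoldenVec.toE3_smul, inner_add_left, inner_smul_left,
      conj_trivial] at h5
    set A := inner ℝ p.toE3 u
    set B := inner ℝ q.toE3 u
    set C := inner ℝ r.toE3 u
    have hpos : 0 < A → 0 < C → 0 < B := fun hA hC =>
      (pos_iff_pos_of_mul_pos (by rw [h5]; positivity)).1 h2
    have hneg : A ≤ 0 → C ≤ 0 → B ≤ 0 := fun hA hC => by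
      by_contra hB
      have := mul_pos h2 (not_le.1 hB)
      nlinarith
    by_cases hA : 0 < A <;> by_cases hB : 0 < B <;> by_cases hC : 0 < C <;> simp [hA, hB, hC]
    · exact hB (hpos hA hC)
    · exact (hneg (not_lt.1 hA) (not_lt.1 hC)).not_gt hB

/-- The outward normal of a face or of a cut. -/
def facetNormal : Side ⊕ CutName → GoldenVec := Sum.elim Side.normal cutNormal

/-- The normals of a list of facets, starting with the facet `f`, turn away from `p` until they
reach `-p`. -/
def TurnsFrom (p : GoldenVec) : Side ⊕ CutName → List (Side ⊕ CutName) → Prop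
  | f, [] => facetNormal f = -p
  | f, g :: l => IsBetween p (facetNormal f) (facetNormal g) ∧ TurnsFrom p g l

instance decidableTurnsFrom (p : GoldenVec) :
    ∀ f l, Decidable (TurnsFrom p f l)
  | f, [] => decEq (facetNormal f) (-p)
  | f, g :: l =>
    have := decidableTurnsFrom p g l
    inferInstanceAs (Decidable (IsBetween p (facetNormal f) (facetNormal g) ∧ TurnsFrom p g l))

/-- The normals of a list of facets make a half-turn. -/
def IsHalfTurn : List (Side ⊕ CutName) → Prop
  | f :: g :: l => TurnsFrom (facetNormal f) g l
  | _ => False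

instance : ∀ l, Decidable (IsHalfTurn l)
  | [] => isFalse id
  | [_] => isFalse id
  | f :: g :: l => decidableTurnsFrom (facetNormal f) g l

/-- The sign changes along a list of facets. -/
noncomputable def signChanges (u : E3) (l : List ((Side ⊕ CutName) × (Side ⊕ CutName))) : ℕ :=
  (l.map fun p => signChange u (facetNormal p.1) (facetNormal p.2)).sum

/-- The sum telescopes: the changes from p to f and from f to g merge into the change from p to g.
What remains in the end is the single change from p to -p. -/
theorem TurnsFrom.signChanges {u : E3} {p : GoldenVec} (hp : inner ℝ p.toE3 u ≠ 0) :
    ∀ {f : Side ⊕ CutName} {l : List (Side ⊕ CutName)}, TurnsFrom p f l →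
      signChange u p (facetNormal f) + signChanges u ((f :: l).zip l) = 1
  | f, [], h => by
    have h' : facetNormal f = -p := h
    simp only [signChange, EquiRotunda.signChanges, h', GoldenVec.toE3_neg, inner_neg_left]
    rcases hp.lt_or_gt with hp | hp
    · simp [hp.not_gt, hp]
    · simp [hp, hp.le]
  | f, g :: l, h => by
    have h1 := h.1.signChange_add hp
    have h2 := TurnsFrom.signChanges hp h.2
    simp only [EquiRotunda.signChanges, List.zip_cons_cons, List.map_cons, List.sum_cons] at h2 ⊢
    rw [← add_assoc, h1, h2]

theorem IsHalfTurn.signChanges {u : E3} {l : List (Side ⊕ CutName)} (hl : IsHalfTurn l)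
    (hu : ∀ f ∈ l, inner ℝ (facetNormal f).toE3 u ≠ 0) :
    signChanges u (l.zip l.tail) = 1 := by
  match l, hl with
  | f :: g :: l, hl =>
    have := TurnsFrom.signChanges (hu f (by simp)) hl
    simpa [EquiRotunda.signChanges] using this

/-! ### The number of corners of a shadow -/

/-- A numbering of the faces and cuts. -/
def rank : Side ⊕ CutName → ℕ
  | .inl base => 0
  | .inl top => 1
  | .inl (pent i) => 2 + i
  | .inl (tri i) => 7 + i
  | .inl (up i) => 12 + i
  | .inr (cut1start i) => 17 + i
  | .inr (cut1stop i) => 22 + i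
  | .inr (cut2 i) => 27 + i
  | .inr (cut3 i) => 32 + i
  | .inr (cut4m i) => 37 + i
  | .inr (cut4t i) => 42 + i

/-- A pair of facets, in the order of their numbers. -/
def sortPair (p : (Side ⊕ CutName) × (Side ⊕ CutName)) : (Side ⊕ CutName) × (Side ⊕ CutName) :=
  if rank p.1 ≤ rank p.2 then p else p.swap

theorem signChange_sortPair (u : E3) (p : (Side ⊕ CutName) × (Side ⊕ CutName)) :
    signChange u (facetNormal (sortPair p).1) (facetNormal (sortPair p).2) =
      signChange u (facetNormal p.1) (facetNormal p.2) := by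
  unfold sortPair
  split_ifs
  · rfl
  · exact signChange_comm u _ _

/-- The pairs of adjacent facets at the vertex of a truncation on a directed edge. -/
def dartPairs (κ : Vert → CutName) (d : Dart) :
    Multiset ((Side ⊕ CutName) × (Side ⊕ CutName)) :=
  {(.inr (κ d.src), .inl d.1.sides.1), (.inr (κ d.src), .inl d.1.sides.2),
    (.inl d.1.sides.1, .inl d.1.sides.2)}

/-- The pairs of adjacent facets at the vertices of a truncation. -/
def vertexPairs (κ : Vert → CutName) : Multiset ((Side ⊕ CutName) × (Side ⊕ CutName)) :=
  (Finset.univ.filter fun d : Dart => κ d.src ≠ κ d.tgt).val.bind (dartPairs κ)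

/-- The edges of a truncation, given by pairs of adjacent facets, are partitioned into chains which
make half-turns. -/
structure IsChainPartition (κ : Vert → CutName) (L : List (List (Side ⊕ CutName))) : Prop where
  isHalfTurn : ∀ l ∈ L, IsHalfTurn l
  mem_range : ∀ l ∈ L, ∀ f ∈ l, ∀ c, f = .inr c → ∃ p, κ p = c
  -- The factor 2 arises because each edge of the truncation is listed at both of its ends. Sorting
  -- makes unordered pairs comparable by evaluation.
  pairs : (vertexPairs κ).map sortPair =
    2 • ((L.flatMap fun l => l.zip l.tail).map sortPair : Multiset _)

theorem sum_signChange_vertexPairs {κ : Vert → CutName} {L : List (List (Side ⊕ CutName))}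
    (hL : IsChainPartition κ L) {u : E3}
    (hside : ∀ f : Side, inner ℝ f.normal.toE3 u ≠ 0)
    (hcut : ∀ p, inner ℝ (cutNormal (κ p)).toE3 u ≠ 0) :
    ((vertexPairs κ).map fun p => signChange u (facetNormal p.1) (facetNormal p.2)).sum =
      2 * L.length := by
  have h1 := congrArg (fun M : Multiset ((Side ⊕ CutName) × (Side ⊕ CutName)) =>
    (M.map fun p => signChange u (facetNormal p.1) (facetNormal p.2)).sum) hL.pairs
  simp only [Multiset.map_map, Function.comp_def, signChange_sortPair, Multiset.map_nsmul,
    Multiset.sum_nsmul, Multiset.map_coe, Multiset.sum_coe, List.map_map, smul_eq_mul] at h1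
  rw [h1]
  congr 1
  have h2 : ∀ l ∈ L, signChanges u (l.zip l.tail) = 1 := by
    refine fun l hl => (hL.isHalfTurn l hl).signChanges fun f hf => ?_
    rcases f with f | c
    · exact hside f
    · obtain ⟨p, rfl⟩ := hL.mem_range l hl _ hf c rfl
      exact hcut p
  clear h1 hL
  induction L with
  | nil => rfl
  | cons l L ih =>
    rw [List.flatMap_cons, List.map_append, List.sum_append, ih fun l hl => h2 l (by simp [hl]),
      List.length_cons, add_comm]
    exact congrArg (L.length + ·) (h2 l (by simp))

theorem sum_cutDart (κ : Vert → CutName) (g : Dart → ℕ) : ∑ d : CutDart κ, g d.1 =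
    ((Finset.univ.filter fun d : Dart => κ d.src ≠ κ d.tgt).val.map g).sum :=
  (Finset.sum_subtype (Finset.univ.filter fun d : Dart => κ d.src ≠ κ d.tgt)
    (fun d => Finset.mem_filter_univ d) g).symm

/-- Double counting of pairs of a contour vertex and a contour edge at it. The actual normals of the
cuts are positive multiples of the `cutNormal`, so the sign changes are those of the fixed vectors
in ℤ[φ]. -/
theorem CutPlanes.ncard_isContour {κ : Vert → CutName} (hκ : IsCutSystem κ) (h : CutPlanes κ)
    {L : List (List (Side ⊕ CutName))} (hL : IsChainPartition κ L) {u : E3}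
    (hu : ∀ f, inner ℝ ((polytope hκ h).normal f) u ≠ 0) :
    {d | (polytope hκ h).IsContour u d}.ncard = L.length := by
  have : DecidablePred fun d => (polytope hκ h).IsContour u d := Classical.decPred _
  have hside : ∀ f : Side, inner ℝ f.normal.toE3 u ≠ 0 := fun f => hu (.inl f)
  have hscale : ∀ p, ∃ r : ℝ, 0 < r ∧
      inner ℝ (h.half (κ p)).normal u = r * inner ℝ (cutNormal (κ p)).toE3 u := by
    intro p
    obtain ⟨r, hr, hn⟩ := (h.isCut p).exists_normal_eq
    exact ⟨r, hr, by rw [hn, inner_smul_left, conj_trivial]⟩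
  have hcut : ∀ p, inner ℝ (cutNormal (κ p)).toE3 u ≠ 0 := by
    intro p h0
    obtain ⟨r, -, hr⟩ := hscale p
    exact hu (.inr ⟨κ p, p, rfl⟩) (hr.trans (by rw [h0, mul_zero]))
  -- Among three nonzero signs, either none or exactly two of the three pairs differ.
  have hcontour : ∀ d : CutDart κ, 2 * (if (polytope hκ h).IsContour u d then 1 else 0) =
      ((dartPairs κ d.1).map fun p => signChange u (facetNormal p.1) (facetNormal p.2)).sum := by
    intro d
    obtain ⟨r, hr, hn⟩ := hscale d.1.src
    have hiff : (polytope hκ h).IsContour u d ↔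
        (inner ℝ (cutNormal (κ d.1.src)).toE3 u < 0 ∨ inner ℝ d.1.1.sides.1.normal.toE3 u < 0 ∨
          inner ℝ d.1.1.sides.2.normal.toE3 u < 0) ∧
        (0 < inner ℝ (cutNormal (κ d.1.src)).toE3 u ∨ 0 < inner ℝ d.1.1.sides.1.normal.toE3 u ∨
          0 < inner ℝ d.1.1.sides.2.normal.toE3 u) := by
      have e1 : inner ℝ (h.half (κ d.1.src)).normal u < 0 ↔
          inner ℝ (cutNormal (κ d.1.src)).toE3 u < 0 := by
        rw [hn, ← neg_pos, ← mul_neg, mul_pos_iff_of_pos_left hr, neg_pos]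
      have e2 : 0 < inner ℝ (h.half (κ d.1.src)).normal u ↔
          0 < inner ℝ (cutNormal (κ d.1.src)).toE3 u := by
        rw [hn, mul_pos_iff_of_pos_left hr]
      rw [← e1, ← e2]
      simp only [SimplePolytope.IsContour, Fin.exists_fin_succ, polytope, CutDart.facets]
      simp
    simp only [hiff]
    have h0 := hcut d.1.src
    have h1 := hside d.1.1.sides.1
    have h2 := hside d.1.1.sides.2
    simp only [dartPairs, Multiset.insert_eq_cons, Multiset.map_cons, Multiset.map_singleton,
      Multiset.sum_cons, Multiset.sum_singleton, signChange, facetNormal, Sum.elim_inl,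
      Sum.elim_inr]
    rcases h0.lt_or_gt with h0 | h0 <;> rcases h1.lt_or_gt with h1 | h1 <;>
      rcases h2.lt_or_gt with h2 | h2 <;> simp [h0, h1, h2, h0.not_gt, h1.not_gt, h2.not_gt]
  have hsum : 2 * {d | (polytope hκ h).IsContour u d}.ncard = 2 * L.length := by
    rw [← sum_signChange_vertexPairs hL hside hcut, vertexPairs, Multiset.map_bind,
      Multiset.sum_bind, Set.ncard_eq_toFinset_card', Set.toFinset_ofPred, Finset.card_filter,
      Finset.mul_sum, Finset.sum_congr rfl fun d _ => hcontour d]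
    convert sum_cutDart κ fun d => ((dartPairs κ d).map fun p =>
      signChange u (facetNormal p.1) (facetNormal p.2)).sum
  omega

/-! ### Equiprojectivity of the truncations -/

/-- Existence is carried from the standard rotunda to v by the similarity. For the second claim, an
arbitrary truncation is carried back, identified with a simple polytope and mapped forward again. -/
theorem exists_and_isEquiprojective {κ : Vert → CutName} (hκ : IsCutSystem κ)
    {L : List (List (Side ⊕ CutName))} (hL : IsChainPartition κ L) {C : Set CutName}
    (hC : C = Set.range κ) {v : Vert → E3} (hv : IsPentagonalRotunda v) :
    (∃ P, IsTruncation v C P) ∧ ∀ P, IsTruncation v C P → IsEquiprojective L.length P := by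
  subst hC
  obtain ⟨f, hf⟩ := hv
  obtain rfl : v = f ∘ stdVert := funext hf
  refine ⟨⟨_, IsTruncation.map f ⟨standardCut, fun c _ => isCut_standardCut c, ?_, rfl⟩⟩,
    fun P hP => ?_⟩
  · rintro _ ⟨p, rfl⟩ _ ⟨q, rfl⟩ hne
    refine disjoint_standardCut (Finset.disjoint_left.2 fun k hk hk' => hne ?_)
    rw [hκ.mem_removed_iff] at hk hk'
    rw [← hk, hk']
  · have hP' := hP.map f.symm
    have hcomp : f.symm ∘ f ∘ stdVert = stdVert := funext fun k => f.symm_apply_apply _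
    rw [hcomp] at hP'
    obtain ⟨half, hcut, hdisj, hbody⟩ := hP'
    let h : CutPlanes κ := ⟨half, fun p => hcut _ ⟨p, rfl⟩, hdisj⟩
    have himage : P = f '' (CutPlanes.polytope hκ h).body := by
      rw [CutPlanes.body_polytope, ← hbody, Set.image_image]
      simp
    have := CutPlanes.nonempty_cutDart hκ
    rw [himage]
    exact SimplePolytope.isEquiprojective_image f _ fun u hu =>
      CutPlanes.ncard_isContour hκ h hL hu

/-! ### The two truncations -/

/-- The chain from the base to the top through the `i`-th pentagon. -/
def pentChain (i : Fin 5) : List (Side ⊕ CutName) :=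
  [.inl base, .inl (pent i), .inr (cut4t i), .inl top]

/-- The chain from the top to the base through the `i`-th triangle. -/
def triChain (i : Fin 5) : List (Side ⊕ CutName) :=
  [.inl top, .inl (up i), .inr (cut4m i), .inl (tri i), .inl base]

/-- The chains at a pair of cut2 and cut3. -/
def pairChains (i : Fin 5) : List (List (Side ⊕ CutName)) :=
  [[.inl base, .inr (cut2 i), .inl (tri (i + 2)), .inr (cut4m (i + 2)), .inl (up (i + 2)),
      .inl top],
    [.inr (cut2 i), .inl (pent (i + 2)), .inl (up (i + 1)), .inr (cut4t (i + 1)), .inl (up i),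
      .inl (pent i)],
    [.inr (cut2 i), .inl (pent (i + 3)), .inl (up (i + 3)), .inr (cut4t (i + 4)),
      .inl (up (i + 4)), .inl (pent i)],
    [.inl top, .inr (cut4t i), .inl (pent i), .inr (cut3 i), .inl base],
    [.inr (cut3 i), .inl (tri i), .inl (pent (i + 1)), .inr (cut4m (i + 1)),
      .inl (pent (i + 2)), .inl (tri (i + 2))],
    [.inr (cut3 i), .inl (tri (i + 4)), .inl (pent (i + 4)), .inr (cut4m (i + 3)),
      .inl (pent (i + 3)), .inl (tri (i + 2))]]

/-- The chains at the pair of cut1 at the ends of a path. -/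
def pathChains (i : Fin 5) : List (List (Side ⊕ CutName)) :=
  [[.inr (cut1stop i), .inl base, .inr (cut1start i)],
    [.inr (cut1start i), .inl (pent i), .inl (up (i + 4)), .inr (cut4t (i + 4)),
      .inl (up (i + 3)), .inl (pent (i + 3)), .inr (cut1stop i)],
    [.inr (cut1start i), .inl (tri i), .inl (pent (i + 1)), .inr (cut4m (i + 1)),
      .inl (pent (i + 2)), .inl (tri (i + 2)), .inr (cut1stop i)]]

/-- The cuts of the first truncation. -/
def firstSystem : Vert → CutName
  | a i => ![cut3 0, cut3 1, cut1stop 4, cut2 0, cut2 1] i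
  | b i => ![cut3 0, cut3 1, cut2 0, cut2 1, cut1start 4] i
  | m i => cut4m i
  | t i => cut4t i

/-- The cuts of the second truncation. -/
def secondSystem : Vert → CutName
  | a i => ![cut3 0, cut1stop 3, cut1stop 4, cut2 0, cut1stop 1] i
  | b i => ![cut3 0, cut1start 1, cut2 0, cut1start 3, cut1start 4] i
  | m i => cut4m i
  | t i => cut4t i

/-- The chains of the first truncation. -/
def firstChains : List (List (Side ⊕ CutName)) :=
  [2, 3, 4].map pentChain ++ [4, 0, 1].map triChain ++ [0, 1].flatMap pairChains ++ pathChains 4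

/-- The chains of the second truncation. -/
def secondChains : List (List (Side ⊕ CutName)) :=
  [1, 2, 3, 4].map pentChain ++ [3, 4, 0, 1].map triChain ++ pairChains 0 ++
    [1, 3, 4].flatMap pathChains

theorem isCutSystem_firstSystem : IsCutSystem firstSystem where
  mem_removed_iff := by decide +kernel
  exists_nbr := by decide +kernel
  exists_dart_of_vert := by decide +kernel
  exists_dart_of_side := by decide +kernel

theorem isCutSystem_secondSystem : IsCutSystem secondSystem where
  mem_removed_iff := by decide +kernel
  exists_nbr := by decide +kernel
  exists_dart_of_vert := by decide +kernel
  exists_dart_of_side := by decide +kernel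

/-- The number of chains is 3 + 3 + 2 * 6 + 3 = 21. -/
theorem isChainPartition_firstChains : IsChainPartition firstSystem firstChains where
  isHalfTurn := by decide +kernel
  mem_range := by decide +kernel
  pairs := by decide +kernel

/-- The number of chains is 4 + 4 + 6 + 3 * 3 = 23. -/
theorem isChainPartition_secondChains : IsChainPartition secondSystem secondChains where
  isHalfTurn := by decide +kernel
  mem_range := by decide +kernel
  pairs := by decide +kernel

theorem range_firstSystem : ({cut2 0, cut3 0} ∪ {cut2 1, cut3 1} ∪ {cut1start 4, cut1stop 4} ∪
    upperCuts : Set CutName) = Set.range firstSystem := by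
  have h : ∀ c : CutName, ((((c = cut2 0 ∨ c = cut3 0) ∨ c = cut2 1 ∨ c = cut3 1) ∨
      c = cut1start 4 ∨ c = cut1stop 4) ∨ (∃ i, cut4m i = c) ∨ ∃ i, cut4t i = c) ↔
      ∃ k, firstSystem k = c := by
    decide +kernel
  exact Set.ext h

theorem range_secondSystem : ({cut2 0, cut3 0} ∪ ({cut1start 1, cut1stop 1} ∪
    {cut1start 3, cut1stop 3}) ∪ {cut1start 4, cut1stop 4} ∪ upperCuts : Set CutName) =
      Set.range secondSystem := by
  have h : ∀ c : CutName, ((((c = cut2 0 ∨ c = cut3 0) ∨ (c = cut1start 1 ∨ c = cut1stop 1) ∨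
      c = cut1start 3 ∨ c = cut1stop 3) ∨ c = cut1start 4 ∨ c = cut1stop 4) ∨
      (∃ i, cut4m i = c) ∨ ∃ i, cut4t i = c) ↔ ∃ k, secondSystem k = c := by
    decide +kernel
  exact Set.ext h

end EquiRotunda

theorem mainTheorem5 (v : EquiRotunda.Vert → EquiRotunda.E3)
    (hv : EquiRotunda.IsPentagonalRotunda v) :
    ((∃ P, EquiRotunda.IsFirstEquitruncatedRotunda v P) ∧
      ∀ P, EquiRotunda.IsFirstEquitruncatedRotunda v P → EquiRotunda.IsEquiprojective 21 P) ∧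
    ((∃ P, EquiRotunda.IsSecondEquitruncatedRotunda v P) ∧
      ∀ P, EquiRotunda.IsSecondEquitruncatedRotunda v P →
        EquiRotunda.IsEquiprojective 23 P) :=
  ⟨EquiRotunda.exists_and_isEquiprojective EquiRotunda.isCutSystem_firstSystem
      EquiRotunda.isChainPartition_firstChains EquiRotunda.range_firstSystem hv,
    EquiRotunda.exists_and_isEquiprojective EquiRotunda.isCutSystem_secondSystem
      EquiRotunda.isChainPartition_secondChains EquiRotunda.range_secondSystem hv⟩
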